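/- Let $\mathbb{k}=\mathbb{R}$ or $\mathbb{C}$ and let $\ell\in\{\tfrac12,\tfrac32,\tfrac52,\dots\}$. Let $\mathfrak g$ be the centrally extended spin-$\ell$ conformal Galilei algebra in $1+1$ dimensions: the Lie algebra over $\mathbb{k}$ with basis $C,D,H,M,P_0,\dots,P_{2\ell}$ whose nonzero brackets are, up to antisymmetry, $$[D,H]=2H,\quad [D,C]=-2C,\quad [C,H]=D,\quad [H,P_n]=-nP_{n-1},\quad [D,P_n]=2(\ell-n)P_n,\quad [C,P_n]=(2\ell-n)P_{n+1},$$ $$[P_m,P_n]=\delta_{m+n,2\ell}\,(-1)^{m+\ell+\frac12}\,m!\,(2\ell-m)!\,M .$$ Let $\mathfrak g^+=\mathrm{span}\{H,P_0,\dots,P_{\ell-\frac12}\}$ and $\mathfrak g^-=\mathrm{span}\{C,P_{\ell+\frac12},\dots,P_{2\ell}\}$. A highest weight module of highest weight $(\delta,\mu)\in\mathbb{k}^2$ is a $\mathfrak g$-module generated by a nonzero vector $v$ with $Dv=\delta v$, $Mv=\mu v$ and $\mathfrak g^+v=0$. The Verma module $V^{\delta,\mu}$ is the quotient of $U(\mathfrak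 g)$ by the left ideal generated by $\mathfrak g^+$, $D-\delta$ and $M-\mu$; let $|\delta,\mu\rangle$ be the class of $1$. For a positive integer $q$ put $$|u_{2q}\rangle=\bigl(\alpha_\ell\,\mu\, C-P_{\ell+\frac12}^2\bigr)^q|\delta,\mu\rangle,\qquad \alpha_\ell=2\bigl((\ell-\tfrac12)!\bigr)^2 .$$ Let $\delta,\mu\in\mathbb{k}$ with $\mu\neq0$. Then: 1. $V^{\delta,\mu}$ is an infinite dimensional highest weight module of highest weight $(\delta,\mu)$, and it is irreducible if $\delta\neq q-1-\tfrac12(\ell+\tfrac12)^2$ for every positive integer $q$. 2. If $\delta=q-1-\tfrac12(\ell+\tfrac12)^2$ for a positive integer $q$, then $V^{\delta,\mu}$ is not irreducible, $I^{\delta,\mu}=U(\mathfrak g^-)|u_{2q}\rangle$ is the submodule of $V^{\delta,\mu}$ generated by $|u_{2q}\rangle$, and the quotient $V^{\delta,\mu}/I^{\delta,\mu}$ is an irreducible, infinite dimensional highest weight module of highest weight $(\delta,\mu)$. 3. Every irreducible highest weight module of highest weight $(\delta,\mu)$ is isomorphic to $V^{\delta,\mu}$ in the first case and to $V^{\delta,\mu}/I^{\delta,\mu}$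 in the second, and it is not a highest weight module of any other highest weight $(\delta',\mu')\in\mathbb{k}^2$. -/

import Mathlib

namespace CGA

/-- Labels of the basis `C, D, H, M, P_0, …, P_{2ℓ}` of the centrally extended spin-`ℓ` conformal
Galilei algebra, where `ℓ = N + 1/2` (so `2ℓ = 2N + 1`, `ℓ - 1/2 = N`, `ℓ + 1/2 = N + 1`). -/
inductive Gen (N : ℕ) : Type
  | C : Gen N
  | D : Gen N
  | H : Gen N
  | M : Gen N
  | P : Fin (2 * N + 2) → Gen N

section LieAlg

variable (K : Type*) [Field K] (N : ℕ)

/-- The underlying vector space of the algebra, with basis indexed by `Gen N`. -/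
def Alg : Type _ := Gen N →₀ K

noncomputable instance : AddCommGroup (Alg K N) := inferInstanceAs (AddCommGroup (Gen N →₀ K))

noncomputable instance : Module K (Alg K N) := inferInstanceAs (Module K (Gen N →₀ K))

/-- The basis of the algebra. -/
noncomputable def genBasis : Module.Basis (Gen N) K (Alg K N) :=
  Module.Basis.ofRepr (LinearEquiv.refl K (Gen N →₀ K))

variable {N} in
/-- The basis vector with a given label. -/
noncomputable def gen (g : Gen N) : Alg K N := genBasis K N g

noncomputable def C : Alg K N := gen K Gen.C

noncomputable def D : Alg K N := gen K Gen.D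

noncomputable def H : Alg K N := gen K Gen.H

noncomputable def M : Alg K N := gen K Gen.M

/-- The basis vector `P_n` for `0 ≤ n ≤ 2ℓ = 2N + 1`, and `0` for `n > 2ℓ`. -/
noncomputable def P (n : ℕ) : Alg K N :=
  if h : n < 2 * N + 2 then gen K (Gen.P ⟨n, h⟩) else 0

/-- The structure constants `I_m = (-1)^(m + ℓ + 1/2) m! (2ℓ - m)!`, for `0 ≤ m ≤ 2ℓ`. -/
def strI (m : ℕ) : K := (-1) ^ (m + N + 1) * (m.factorial : K) * ((2 * N + 1 - m).factorial : K)

/-- Brackets of basis vectors. The nonzero ones are, up to antisymmetry,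
`[D, H] = 2H`, `[D, C] = -2C`, `[C, H] = D`, `[H, P_n] = -n P_{n-1}`,
`[D, P_n] = 2(ℓ - n) P_n`, `[C, P_n] = (2ℓ - n) P_{n+1}`, `[P_m, P_n] = δ_{m+n,2ℓ} I_m M`. -/
noncomputable def br : Gen N → Gen N → Alg K N
  | .D, .H => (2 : K) • H K N
  | .H, .D => -((2 : K) • H K N)
  | .D, .C => (-2 : K) • C K N
  | .C, .D => -((-2 : K) • C K N)
  | .C, .H => D K N
  | .H, .C => -(D K N)
  | .H, .P n => (-((n : ℕ) : K)) • P K N (n - 1)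
  | .P n, .H => -((-((n : ℕ) : K)) • P K N (n - 1))
  | .D, .P n => (2 * (N : K) + 1 - 2 * ((n : ℕ) : K)) • P K N n
  | .P n, .D => -((2 * (N : K) + 1 - 2 * ((n : ℕ) : K)) • P K N n)
  | .C, .P n => (2 * (N : K) + 1 - ((n : ℕ) : K)) • P K N (n + 1)
  | .P n, .C => -((2 * (N : K) + 1 - ((n : ℕ) : K)) • P K N (n + 1))
  | .P m, .P n => if (m : ℕ) + (n : ℕ) = 2 * N + 1 then strI K N m • M K N else 0
  | _, _ => 0

/-- The bilinear extension of `br`. -/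
noncomputable def brL : Alg K N →ₗ[K] Alg K N →ₗ[K] Alg K N :=
  (genBasis K N).constr K fun i => (genBasis K N).constr K fun j => br K N i j

noncomputable instance : Bracket (Alg K N) (Alg K N) := ⟨fun x y => brL K N x y⟩

theorem lie_def (x y : Alg K N) : ⁅x, y⁆ = brL K N x y := rfl

theorem brL_gen (i j : Gen N) : brL K N (gen K i) (gen K j) = br K N i j := by
  simp only [brL, gen, Module.Basis.constr_basis]

theorem lie_gen (i j : Gen N) : ⁅gen K i, gen K j⁆ = br K N i j := brL_gen K N i j

variable {K N} in
theorem alg_hom_ext {V : Type*} [AddCommGroup V] [Module K V] {f g : Alg K N →ₗ[K] V}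
    (h : ∀ i, f (gen K i) = g (gen K i)) : f = g :=
  (genBasis K N).ext h

theorem P_val (n : Fin (2 * N + 2)) : gen K (Gen.P n) = P K N n := by
  simp [P]

variable {N} in
theorem br_swap (i j : Gen N) : br K N i j = -br K N j i := by
  cases i <;> cases j <;> try simp [br]
  rename_i a b
  rw [add_comm (b : ℕ)]
  split_ifs with h
  · rw [← neg_smul]
    congr 1
    have e1 : 2 * N + 1 - (a : ℕ) = b := by omega
    have e2 : 2 * N + 1 - (b : ℕ) = a := by omega
    have e3 : ((-1 : K)) ^ ((a : ℕ) + N + 1) = -(-1) ^ ((b : ℕ) + N + 1) := by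
      have h1 : ((-1 : K)) ^ ((a : ℕ) + N + 1) * (-1) ^ ((b : ℕ) + N + 1) = -1 := by
        rw [← pow_add]
        exact Odd.neg_one_pow ⟨2 * N + 1, by omega⟩
      have h2 : ((-1 : K)) ^ ((b : ℕ) + N + 1) * (-1) ^ ((b : ℕ) + N + 1) = 1 := by
        rw [← pow_add]
        exact Even.neg_one_pow ⟨_, rfl⟩
      linear_combination (-1 : K) ^ ((b : ℕ) + N + 1) * h1 - (-1 : K) ^ ((a : ℕ) + N + 1) * h2
    unfold strI
    rw [e1, e2, e3]
    ring
  · simp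

theorem br_self (i : Gen N) : br K N i i = 0 := by
  cases i <;> simp [br]
  intro h
  omega

theorem brL_P (m n : ℕ) : brL K N (P K N m) (P K N n) =
    if m + n = 2 * N + 1 then strI K N m • M K N else 0 := by
  unfold P
  split_ifs <;> first | (simp [brL_gen, br]; done) | (simp [brL_gen, br]; omega)

theorem brL_H_P {n : ℕ} (h : n < 2 * N + 2) : brL K N (H K N) (P K N n) =
    (-(n : K)) • P K N (n - 1) := by
  conv_lhs => unfold P
  simp [H, brL_gen, br, h]

theorem brL_D_P (n : ℕ) : brL K N (D K N) (P K N n) =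
    (2 * (N : K) + 1 - 2 * (n : K)) • P K N n := by
  by_cases h : n < 2 * N + 2
  · conv_lhs => unfold P
    simp [D, brL_gen, br, h]
  · simp [P, h]

theorem brL_C_P (n : ℕ) : brL K N (C K N) (P K N n) =
    (2 * (N : K) + 1 - (n : K)) • P K N (n + 1) := by
  by_cases h : n < 2 * N + 2
  · conv_lhs => unfold P
    simp [C, brL_gen, br, h]
  · have h' : ¬ n + 1 < 2 * N + 2 := by omega
    simp [P, h, h']

theorem brL_swap (x y : Alg K N) : brL K N x y = -brL K N y x := by
  have : brL K N = -(brL K N).flip := by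
    refine alg_hom_ext fun i => alg_hom_ext fun j => ?_
    simp [brL_gen, br_swap K i j]
  exact congrArg (fun f => f x y) this

theorem brL_M_left (x : Alg K N) : brL K N (M K N) x = 0 := by
  have : brL K N (M K N) = 0 := by
    refine alg_hom_ext fun i => ?_
    cases i <;> simp [M, brL_gen, br]
  rw [this]
  rfl

theorem brL_M_right (x : Alg K N) : brL K N x (M K N) = 0 := by
  rw [brL_swap, brL_M_left, neg_zero]

/-- The cyclic sum in the Jacobi identity. -/
noncomputable def jac (x y z : Alg K N) : Alg K N :=
  brL K N x (brL K N y z) + brL K N y (brL K N z x) + brL K N z (brL K N x y)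

theorem jac_rot (x y z : Alg K N) : jac K N x y z = jac K N y z x := by
  unfold jac
  abel

theorem jac_swap (x y z : Alg K N) : jac K N x y z = -jac K N y x z := by
  unfold jac
  rw [brL_swap K N y z, brL_swap K N z x, brL_swap K N x y]
  simp only [map_neg]
  abel

theorem brL_C_H : brL K N (C K N) (H K N) = D K N := by simp [C, H, brL_gen, br]

theorem brL_D_H : brL K N (D K N) (H K N) = (2 : K) • H K N := by simp [D, H, brL_gen, br]

theorem brL_D_C : brL K N (D K N) (C K N) = (-2 : K) • C K N := by simp [D, C, brL_gen, br]

theorem jac_CDH : jac K N (C K N) (D K N) (H K N) = 0 := by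
  have h0 : brL K N (D K N) (D K N) = 0 := by simp [D, brL_gen, br]
  unfold jac
  rw [brL_swap K N (H K N) (C K N), brL_swap K N (C K N) (D K N), brL_D_H, brL_D_C, brL_C_H,
    brL_swap K N (H K N)]
  simp only [map_smul, map_neg, LinearMap.neg_apply, LinearMap.smul_apply, h0, brL_C_H]
  module

theorem jac_CHP {n : ℕ} (h : n < 2 * N + 2) : jac K N (C K N) (H K N) (P K N n) = 0 := by
  unfold jac
  rw [brL_swap K N (P K N n) (C K N), brL_C_H, brL_swap K N (P K N n) (D K N), brL_H_P K N h,
    brL_C_P, brL_D_P]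
  simp only [map_smul, map_neg, brL_C_P]
  rcases Nat.lt_or_ge (n + 1) (2 * N + 2) with h1 | h1
  · rw [brL_H_P K N h1]
    rcases n with _ | n
    · simp
    · simp
      module
  · have h2 : n = 2 * N + 1 := by omega
    subst h2
    have h3 : P K N (2 * N + 1 + 1) = 0 := by simp [P]
    rw [h3]
    simp
    module

theorem jac_CDP {n : ℕ} : jac K N (C K N) (D K N) (P K N n) = 0 := by
  unfold jac
  rw [brL_swap K N (P K N n) (C K N), brL_swap K N (C K N) (D K N), brL_D_C,
    brL_swap K N (P K N n)]
  simp only [map_smul, map_neg, LinearMap.neg_apply, LinearMap.smul_apply, brL_C_P, brL_D_P]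
  push_cast
  module

theorem jac_HDP {n : ℕ} (h : n < 2 * N + 2) : jac K N (H K N) (D K N) (P K N n) = 0 := by
  unfold jac
  rw [brL_swap K N (P K N n) (H K N), brL_swap K N (H K N) (D K N), brL_D_H,
    brL_swap K N (P K N n)]
  simp only [map_smul, map_neg, LinearMap.neg_apply, LinearMap.smul_apply, brL_H_P K N h, brL_D_P]
  rcases n with _ | n
  · simp
  · simp
    module

theorem strI_even {m n : ℕ} (h : Even (m + n)) :
    ((-1 : K)) ^ (m + N + 1) = (-1) ^ (n + N + 1) := by
  rw [neg_one_pow_congr]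
  grind

theorem strI_swap {m n : ℕ} (h : m + n = 2 * N + 1) : strI K N n = -strI K N m := by
  have h1 : 2 * N + 1 - m = n := by omega
  have h2 : 2 * N + 1 - n = m := by omega
  have h3 : ((-1 : K)) ^ (n + N + 1) = (-1) ^ (m + 1 + N + 1) :=
    strI_even K N (by grind)
  unfold strI
  rw [h1, h2, h3]
  ring

theorem jac_DPP (m n : ℕ) : jac K N (D K N) (P K N m) (P K N n) = 0 := by
  unfold jac
  rw [brL_swap K N (P K N n) (D K N)]
  simp only [map_smul, map_neg, brL_D_P, brL_P, add_comm n m]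
  split_ifs with h
  · have h1 : (m : K) + n = 2 * N + 1 := by
      have := congrArg (Nat.cast (R := K)) h
      push_cast at this
      exact this
    rw [strI_swap K N h, map_smul, brL_M_right, ← sub_eq_zero]
    simp only [smul_zero, zero_add, smul_smul, ← neg_smul, ← add_smul, sub_zero]
    rw [show -((2 * (N : K) + 1 - 2 * n) * strI K N m) +
      (2 * (N : K) + 1 - 2 * m) * -strI K N m = 0 by
        linear_combination (2 * strI K N m) * h1, zero_smul]
  · simp

theorem jac_CPP (m n : ℕ) : jac K N (C K N) (P K N m) (P K N n) = 0 := by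
  unfold jac
  rw [brL_swap K N (P K N n) (C K N)]
  simp only [map_smul, map_neg, brL_C_P, brL_P]
  have h0 : (brL K N (C K N)) (if m + n = 2 * N + 1 then strI K N m • M K N else 0) = 0 := by
    split_ifs <;> simp [brL_M_right]
  rw [h0, zero_add]
  by_cases h : m + n = 2 * N
  · have h1 : (m : K) + n = 2 * N := by
      have := congrArg (Nat.cast (R := K)) h
      push_cast at this
      exact this
    have e1 : m + (n + 1) = 2 * N + 1 := by omega
    have e2 : n + (m + 1) = 2 * N + 1 := by omega
    have e3 : 2 * N + 1 - m = n + 1 := by omega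
    have e4 : 2 * N + 1 - n = m + 1 := by omega
    rw [if_pos e1, if_pos e2, smul_smul, smul_smul, ← neg_smul, ← add_smul]
    have : -((2 * (N : K) + 1 - n) * strI K N m) + (2 * (N : K) + 1 - m) * strI K N n = 0 := by
      unfold strI
      rw [strI_even K N (m := m) (n := n) ⟨N, by omega⟩, e3, e4, Nat.factorial_succ,
        Nat.factorial_succ, ← h1]
      push_cast
      ring
    rw [this, zero_smul]
  · rw [if_neg (by omega), if_neg (by omega)]
    simp

theorem jac_HPP {m n : ℕ} (hm : m < 2 * N + 2) (hn : n < 2 * N + 2) :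
    jac K N (H K N) (P K N m) (P K N n) = 0 := by
  unfold jac
  rw [brL_swap K N (P K N n) (H K N)]
  simp only [map_smul, map_neg, brL_H_P K N hm, brL_H_P K N hn, brL_P]
  have h0 : (brL K N (H K N)) (if m + n = 2 * N + 1 then strI K N m • M K N else 0) = 0 := by
    split_ifs <;> simp [brL_M_right]
  rw [h0, zero_add]
  rcases m with _ | m <;> rcases n with _ | n
  · simp
  · rw [if_neg (by omega)]
    simp
  · rw [if_neg (c := 0 + _ = _) (by omega)]
    simp
  · by_cases h : m + n = 2 * N
    · have e1 : m + 1 + n = 2 * N + 1 := by omega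
      have e2 : n + 1 + m = 2 * N + 1 := by omega
      have e3 : 2 * N + 1 - (m + 1) = n := by omega
      have e4 : 2 * N + 1 - (n + 1) = m := by omega
      simp only [Nat.add_sub_cancel]
      rw [if_pos e1, if_pos e2, smul_smul, smul_smul, ← neg_smul, ← add_smul]
      have : -(-((n + 1 : ℕ) : K) * strI K N (m + 1)) +
          -((m + 1 : ℕ) : K) * strI K N (n + 1) = 0 := by
        unfold strI
        rw [strI_even K N (m := m + 1) (n := n + 1) ⟨N + 1, by omega⟩, e3, e4,
          Nat.factorial_succ, Nat.factorial_succ]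
        push_cast
        ring
      rw [this, zero_smul]
    · simp only [Nat.add_sub_cancel]
      rw [if_neg (by omega), if_neg (by omega)]
      simp

theorem jac_PPP (k m n : ℕ) : jac K N (P K N k) (P K N m) (P K N n) = 0 := by
  unfold jac
  simp only [brL_P]
  split_ifs <;> simp [brL_M_right]

theorem jac_M (x y : Alg K N) : jac K N (M K N) x y = 0 := by
  simp [jac, brL_M_left, brL_M_right]

theorem brL_self [CharZero K] (x : Alg K N) : brL K N x x = 0 := by
  have h := brL_swap K N x x
  rw [eq_neg_iff_add_eq_zero, ← two_smul K] at h
  exact (smul_eq_zero.mp h).resolve_left two_ne_zero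

theorem jac_self [CharZero K] (x y : Alg K N) : jac K N x x y = 0 := by
  unfold jac
  rw [brL_self, brL_swap K N y x]
  simp

variable {K N} in
theorem jac_perm {x y z : Alg K N} (h : jac K N x y z = 0) :
    jac K N y z x = 0 ∧ jac K N z x y = 0 ∧ jac K N y x z = 0 ∧ jac K N x z y = 0 ∧
      jac K N z y x = 0 := by
  have h1 : jac K N y z x = 0 := by rw [← jac_rot, h]
  have h2 : jac K N z x y = 0 := by rw [← jac_rot, h1]
  refine ⟨h1, h2, ?_, ?_, ?_⟩
  · rw [jac_swap, h, neg_zero]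
  · rw [jac_swap, h2, neg_zero]
  · rw [jac_swap, h1, neg_zero]

theorem jac_gen [CharZero K] (i j k : Gen N) :
    jac K N (gen K i) (gen K j) (gen K k) = 0 := by
  have hC : gen K (Gen.C : Gen N) = C K N := rfl
  have hD : gen K (Gen.D : Gen N) = D K N := rfl
  have hH : gen K (Gen.H : Gen N) = H K N := rfl
  have hM : gen K (Gen.M : Gen N) = M K N := rfl
  have base : ∀ x y z : Alg K N,
      (jac K N x y z = 0 ∨ jac K N y z x = 0 ∨ jac K N z x y = 0 ∨ jac K N y x z = 0 ∨
        jac K N x z y = 0 ∨ jac K N z y x = 0) → jac K N x y z = 0 := by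
    intro x y z h
    rcases h with h | h | h | h | h | h
    · exact h
    · exact (jac_perm h).2.1
    · exact (jac_perm h).1
    · exact (jac_perm h).2.2.1
    · exact (jac_perm h).2.2.2.1
    · exact (jac_perm h).2.2.2.2
  apply base
  cases i <;> cases j <;> cases k <;>
    simp only [hC, hD, hH, hM, P_val, jac_M, jac_self, jac_PPP, jac_CPP, jac_DPP, jac_CDP,
      jac_CDH, jac_CHP, jac_HPP, jac_HDP, Fin.is_lt, true_or, or_true]

theorem jac_eq_zero [CharZero K] (x y z : Alg K N) : jac K N x y z = 0 := by
  have hj : ∀ a b c, jac K N a b c = brL K N a (brL K N b c) - brL K N b (brL K N a c) -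
      brL K N (brL K N a b) c := by
    intro a b c
    unfold jac
    rw [brL_swap K N c a, brL_swap K N c (brL K N a b), map_neg]
    abel
  have key : (LinearMap.llcomp K (Alg K N) (Alg K N) (Alg K N)).compl₁₂ (brL K N) (brL K N) -
      ((LinearMap.llcomp K (Alg K N) (Alg K N) (Alg K N)).compl₁₂ (brL K N) (brL K N)).flip -
      (brL K N).compr₂ (brL K N) = 0 := by
    refine alg_hom_ext fun i => alg_hom_ext fun j => alg_hom_ext fun k => ?_
    have h := jac_gen K N i j k
    rw [hj] at h
    exact h
  rw [hj]
  exact congrArg (fun f => f x y z) key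

noncomputable instance [CharZero K] : LieRing (Alg K N) where
  add_lie x y z := by simp [lie_def]
  lie_add x y z := by simp [lie_def]
  lie_self x := brL_self K N x
  leibniz_lie x y z := by
    have h := jac_eq_zero K N x y z
    unfold jac at h
    simp only [lie_def]
    rw [brL_swap K N z x, brL_swap K N z (brL K N x y), map_neg] at h
    rw [← sub_eq_zero, ← h]
    abel

noncomputable instance [CharZero K] : LieAlgebra K (Alg K N) where
  lie_smul t x y := by simp [lie_def]

end LieAlg

section Verma

variable (K : Type*) [Field K] [CharZero K] (N : ℕ)

attribute [local instance 100] LieRing.ofAssociativeRing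

/-- The universal enveloping algebra `U(g)`. -/
abbrev U : Type _ := UniversalEnvelopingAlgebra K (Alg K N)

/-- The canonical map `g → U(g)`. -/
noncomputable abbrev toU : Alg K N →ₗ⁅K⁆ U K N := UniversalEnvelopingAlgebra.ι K

/-- The spanning set `{H, P_0, …, P_{ℓ-1/2}}` of `g⁺`. -/
def gPlus : Set (Alg K N) := {x | x = H K N ∨ ∃ n, n ≤ N ∧ x = P K N n}

/-- The spanning set `{C, P_{ℓ+1/2}, …, P_{2ℓ}}` of `g⁻`. -/
def gMinus : Set (Alg K N) := {x | x = C K N ∨ ∃ n, N + 1 ≤ n ∧ n ≤ 2 * N + 1 ∧ x = P K N n}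

/-- The subalgebra of `U(g)` generated by `g⁻`, that is, the image of `U(g⁻)` in `U(g)`. -/
noncomputable def UMinus : Subalgebra K (U K N) := Algebra.adjoin K (toU K N '' gMinus K N)

variable {K}

/-- The left ideal of `U(g)` generated by `g⁺`, `D - δ` and `M - μ`. -/
noncomputable def vermaIdeal (δ μ : K) : Submodule (U K N) (U K N) :=
  Submodule.span (U K N) (toU K N '' gPlus K N ∪
    {toU K N (D K N) - algebraMap K (U K N) δ, toU K N (M K N) - algebraMap K (U K N) μ})

/-- The Verma module `V^{δ,μ}` of highest weight `(δ, μ)`. -/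
abbrev Verma (δ μ : K) : Type _ := U K N ⧸ vermaIdeal N δ μ

/-- `g` acts on the Verma module through `U(g)`. -/
noncomputable instance (δ μ : K) : LieRingModule (Alg K N) (Verma N δ μ) where
  bracket x v := toU K N x • v
  add_lie x y v := by
    change toU K N (x + y) • v = toU K N x • v + toU K N y • v
    rw [map_add, add_smul]
  lie_add x v w := smul_add _ v w
  leibniz_lie x y v := by
    change toU K N x • toU K N y • v = toU K N ⁅x, y⁆ • v + toU K N y • toU K N x • v
    rw [LieHom.map_lie, LieRing.of_associative_ring_bracket, sub_smul, mul_smul, mul_smul,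
      sub_add_cancel]

theorem verma_lie_def (δ μ : K) (x : Alg K N) (v : Verma N δ μ) : ⁅x, v⁆ = toU K N x • v := rfl

noncomputable instance (δ μ : K) : LieModule K (Alg K N) (Verma N δ μ) where
  smul_lie t x v := by
    rw [verma_lie_def, verma_lie_def, map_smul, smul_assoc]
  lie_smul t x v := by
    rw [verma_lie_def, verma_lie_def, smul_comm]

/-- The highest weight vector `|δ,μ⟩` of the Verma module. -/
noncomputable def hwv (δ μ : K) : Verma N δ μ := Submodule.Quotient.mk 1

/-- The vector `|u_{2q}⟩ = (α_ℓ μ C - P_{ℓ+1/2}²)^q |δ,μ⟩`, where `α_ℓ = 2 ((ℓ - 1/2)!)²`. -/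
noncomputable def singVec (δ μ : K) (q : ℕ) : Verma N δ μ :=
  ((2 * (N.factorial : K) ^ 2 * μ) • toU K N (C K N) - toU K N (P K N (N + 1)) ^ 2) ^ q • hwv N δ μ

/-- The submodule of `V^{δ,μ}` generated by `|u_{2q}⟩`. -/
noncomputable def singSub (δ μ : K) (q : ℕ) : LieSubmodule K (Alg K N) (Verma N δ μ) :=
  LieSubmodule.lieSpan K (Alg K N) {singVec N δ μ q}

/-- The subspace `U(g⁻) v` of `V^{δ,μ}`. -/
noncomputable def UMinusSpan {δ μ : K} (v : Verma N δ μ) : Submodule K (Verma N δ μ) :=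
  (Subalgebra.toSubmodule (UMinus K N)).map
    ((LinearMap.toSpanSingleton (U K N) (Verma N δ μ) v).restrictScalars K)

/-- `W` is a highest weight module of highest weight `(δ, μ)`: it is generated by a nonzero
vector `v` with `D v = δ v`, `M v = μ v` and `X v = 0` for all `X ∈ g⁺`. -/
def IsHighestWeightModule (δ μ : K) (W : Type*) [AddCommGroup W] [Module K W]
    [LieRingModule (Alg K N) W] [LieModule K (Alg K N) W] : Prop :=
  ∃ v : W, v ≠ 0 ∧ ⁅D K N, v⁆ = δ • v ∧ ⁅M K N, v⁆ = μ • v ∧ (∀ x ∈ gPlus K N, ⁅x, v⁆ = 0) ∧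
    LieSubmodule.lieSpan K (Alg K N) {v} = ⊤

/-- The number `q - 1 - (1/2) (ℓ + 1/2)²`, where `ℓ = N + 1/2`. -/
def excWeight (K : Type*) [Field K] (N q : ℕ) : K :=
  (q : K) - 1 - 1 / 2 * (((N : K) + 1 / 2) + 1 / 2) ^ 2

end Verma

end CGA

/-! Since `M` acts by the nonzero scalar `μ`, the operators `P_n` generate a Weyl algebra, with
`P_n` and `P_{2N+1-n}` conjugate up to a nonzero scalar. The adjoint actions of `C`, `D`, `H` on the
`P_n` are infinitesimally symplectic, so they are also produced by quadratic elements in the `P_n`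
(`quadC`, `quadD`, `quadH`). Subtracting these from `C`, `D`, `H` leaves operators `c`, `d`, `h`
that commute with every `P_n` and again form an `sl₂`-triple (`exists_sl2`). Modules with `M = μ`
are thus modules over a Weyl algebra together with a commuting `sl₂`.

A highest weight vector is a vacuum for the Weyl algebra and a highest weight vector for this `sl₂`.
On the vacuum `quadH` vanishes, `quadD` is the scalar `-(N+1)²/2`, and `quadC` is `P_{N+1}²/(α_ℓ
μ)`. Hence the `sl₂`-weight is `lam = δ + (N+1)²/2`, and on vacuum vectors `α_ℓ μ c` acts as `α_ℓ μ
C - P_{N+1}²`, which explains the shape of `|u_{2q}⟩`.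

The Verma module is then realized on polynomials (`exists_verma_equiv`): the variables `some i`
carry the Fock representation of the Weyl algebra, and `none` carries the `sl₂` Verma module, with
`h = x∂² - lam ∂`. The derivatives in the `some i` reduce the submodule problem to `sl₂`: `h x^k =
k(k-1-lam) x^(k-1)`, so every nonzero submodule contains `1` unless `lam = q - 1` for some `q ≥ 1`
(`one_mem_of_reduction`). In that case the multiples of `x^q` form a maximal submodule, generated by
the image of `|u_{2q}⟩` up to a nonzero scalar.

Completeness uses the universal property of the Verma module. In an irreducible quotient at an
exceptional weight the image of `|u_{2q}⟩` must be zero, since otherwise it would generate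
everything from the lower weight `δ - 2q`. Eigenvalues of `D` lie in `δ - ℕ`, which also determines
`δ`. Infinite dimensionality follows from the trace of `[P_N, P_{N+1}]`, a nonzero scalar operator.
-/

namespace CGA

/-! ### The Weyl algebra of the `P_n` and its quadratic elements -/

section Heisenberg

variable {K : Type*} [Field K] {A : Type*} [Ring A] [Algebra K A]

/-- A family satisfying the commutation relations of the elements `P_n`, with `M` replaced by the
scalar `μ`. -/
structure IsHeisenberg (N : ℕ) (μ : K) (p : ℕ → A) : Prop where
  eq_zero : ∀ n, 2 * N + 2 ≤ n → p n = 0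
  comm : ∀ m n, p m * p n - p n * p m = if m + n = 2 * N + 1 then (strI K N m * μ) • 1 else 0

/-- The quadratic element `-(1 / 2μ) ∑ w_n e_n`, where `e_n` is dual to `p_n`. -/
def quad (N : ℕ) (μ : K) (p w : ℕ → A) : A :=
  (-(1 / (2 * μ))) • ∑ n ∈ Finset.range (2 * N + 2), (strI K N n)⁻¹ • (w n * p (2 * N + 1 - n))

variable (K) in
/-- The family `[C, P_n]`. -/
def adC (N : ℕ) (p : ℕ → A) (n : ℕ) : A := (2 * (N : K) + 1 - (n : K)) • p (n + 1)

variable (K) in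
/-- The family `[D, P_n]`. -/
def adD (N : ℕ) (p : ℕ → A) (n : ℕ) : A := (2 * (N : K) + 1 - 2 * (n : K)) • p n

variable (K) in
/-- The family `[H, P_n]`. -/
def adH (p : ℕ → A) (n : ℕ) : A := (-(n : K)) • p (n - 1)

/-- The quadratic element whose commutators with `p_n` are those of `C`. -/
def quadC (N : ℕ) (μ : K) (p : ℕ → A) : A := quad N μ p (adC K N p)

/-- The quadratic element whose commutators with `p_n` are those of `D`. -/
def quadD (N : ℕ) (μ : K) (p : ℕ → A) : A := quad N μ p (adD K N p)

/-- The quadratic element whose commutators with `p_n` are those of `H`. -/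
def quadH (N : ℕ) (μ : K) (p : ℕ → A) : A := quad N μ p (adH K p)

theorem strI_ne_zero [CharZero K] (N m : ℕ) : strI K N m ≠ 0 := by
  unfold strI
  have h1 : (m.factorial : K) ≠ 0 := by exact_mod_cast m.factorial_ne_zero
  have h2 : ((2 * N + 1 - m).factorial : K) ≠ 0 := by exact_mod_cast Nat.factorial_ne_zero _
  simp [h1, h2]

theorem sub_mul_strI {N n : ℕ} (h : n < 2 * N + 1) :
    (2 * (N : K) + 1 - n) * strI K N (n + 1) = -(((n : K) + 1) * strI K N n) := by
  obtain ⟨k, hk⟩ : ∃ k, 2 * N = n + k := ⟨2 * N - n, by omega⟩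
  have hk' : (2 * (N : K)) = n + k := by
    have := congrArg (Nat.cast (R := K)) hk
    push_cast at this
    exact this
  unfold strI
  rw [show 2 * N + 1 - (n + 1) = k by omega, show 2 * N + 1 - n = k + 1 by omega, hk',
    Nat.factorial_succ, Nat.factorial_succ, show n + 1 + N + 1 = n + N + 1 + 1 by ring, pow_succ]
  push_cast
  ring

namespace IsHeisenberg

variable {N : ℕ} {μ : K} {p : ℕ → A} (hp : IsHeisenberg N μ p)

include hp

theorem comm_of_ne {m n : ℕ} (h : m + n ≠ 2 * N + 1) : p m * p n = p n * p m := by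
  have := hp.comm m n
  rwa [if_neg h, sub_eq_zero] at this

variable [CharZero K]

/-- Expansion of `q` in the basis dual to the `p n` under the commutator form. For `q = p k` only `n
= 2N+1-k` contributes, and the sign comes from the antisymmetry of the structure constants. -/
theorem sum_dual {q : A} (hq : q ∈ Submodule.span K (Set.range p)) :
    ∑ n ∈ Finset.range (2 * N + 2),
      (strI K N n)⁻¹ • ((q * p n - p n * q) * p (2 * N + 1 - n)) = -(μ • q) := by
  induction hq using Submodule.span_induction with
  | mem q hq =>
    obtain ⟨k, rfl⟩ := hq
    rcases Nat.lt_or_ge k (2 * N + 2) with hk | hk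
    · rw [Finset.sum_eq_single (2 * N + 1 - k)]
      · rw [hp.comm, if_pos (by omega), show 2 * N + 1 - (2 * N + 1 - k) = k by omega,
          strI_swap K N (m := k) (n := 2 * N + 1 - k) (by omega), smul_mul_assoc, one_mul,
          smul_smul, ← neg_smul]
        congr 1
        have := strI_ne_zero (K := K) N k
        field_simp
      · intro n hn hne
        have := Finset.mem_range.mp hn
        rw [hp.comm, if_neg (by omega)]
        simp
      · intro h
        exact absurd (Finset.mem_range.mpr (by omega)) h
    · simp [hp.eq_zero k hk]
  | zero => simp
  | add x y _ _ hx hy =>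
    rw [smul_add, neg_add, ← hx, ← hy, ← Finset.sum_add_distrib]
    refine Finset.sum_congr rfl fun n _ => ?_
    rw [← smul_add]
    congr 1
    noncomm_ring
  | smul a x _ hx =>
    rw [smul_comm, ← smul_neg, ← hx, Finset.smul_sum]
    refine Finset.sum_congr rfl fun n _ => ?_
    rw [smul_comm a]
    congr 1
    simp only [smul_mul_assoc, mul_smul_comm, ← smul_sub]

/-- If `w n = [X, p n]` with central brackets `[p n, p m]`, the Jacobi identity gives the symmetry
`sym`; it says that `p n ↦ w n` is infinitesimally symplectic. By the product rule `[quad, p m]` is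
a sum of two parts: one collapses by duality, the other becomes `sum_dual` after applying `sym`.
Each contributes `-μ w m`, whence the normalization `-1/(2μ)`. -/
theorem quad_comm (hμ : μ ≠ 0) {w : ℕ → A} (hw : ∀ n, w n ∈ Submodule.span K (Set.range p))
    (sym : ∀ m n, m < 2 * N + 2 → n < 2 * N + 2 →
      w n * p m - p m * w n = w m * p n - p n * w m) {m : ℕ} (hm : m < 2 * N + 2) :
    quad N μ p w * p m - p m * quad N μ p w = w m := by
  have h1 : ∑ n ∈ Finset.range (2 * N + 2), (strI K N n)⁻¹ •
      (w n * (p (2 * N + 1 - n) * p m - p m * p (2 * N + 1 - n))) = -(μ • w m) := by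
    rw [Finset.sum_eq_single m]
    · rw [hp.comm, if_pos (by omega), strI_swap K N (m := m) (n := 2 * N + 1 - m) (by omega),
        mul_smul_comm, mul_one, smul_smul, ← neg_smul]
      congr 1
      have := strI_ne_zero (K := K) N m
      field_simp
    · intro n hn hne
      have := Finset.mem_range.mp hn
      rw [hp.comm, if_neg (by omega)]
      simp
    · intro h
      exact absurd (Finset.mem_range.mpr hm) h
  have h2 := hp.sum_dual (hw m)
  unfold quad
  rw [smul_mul_assoc, mul_smul_comm, ← smul_sub, Finset.sum_mul, Finset.mul_sum,
    ← Finset.sum_sub_distrib]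
  have h3 : ∑ n ∈ Finset.range (2 * N + 2),
      ((strI K N n)⁻¹ • (w n * p (2 * N + 1 - n)) * p m -
        p m * (strI K N n)⁻¹ • (w n * p (2 * N + 1 - n))) = -((2 * μ) • w m) := by
    rw [show -((2 * μ) • w m) = -(μ • w m) + -(μ • w m) by module]
    nth_rewrite 1 [← h1]
    rw [← h2, ← Finset.sum_add_distrib]
    refine Finset.sum_congr rfl fun n hn => ?_
    rw [← sym m n hm (Finset.mem_range.mp hn), smul_mul_assoc, mul_smul_comm, ← smul_sub,
      ← smul_add]
    congr 1
    noncomm_ring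
  rw [h3, smul_neg, neg_smul, neg_neg, smul_smul]
  rw [one_div_mul_cancel (by simpa using hμ), one_smul]

omit [CharZero K] hp in
theorem mem_span_range (n : ℕ) : p n ∈ Submodule.span K (Set.range p) :=
  Submodule.subset_span ⟨n, rfl⟩

theorem quadC_comm (hμ : μ ≠ 0) (m : ℕ) :
    quadC N μ p * p m - p m * quadC N μ p = adC K N p m := by
  rcases Nat.lt_or_ge m (2 * N + 2) with hm | hm
  · refine hp.quad_comm hμ (fun n => Submodule.smul_mem _ _ (mem_span_range _)) ?_ hm
    intro m n _ _
    simp only [smul_mul_assoc, mul_smul_comm, ← smul_sub]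
    rw [hp.comm, hp.comm, show m + 1 + n = n + 1 + m by ring]
    split_ifs with h
    · rw [smul_smul, smul_smul]
      congr 1
      rw [← mul_assoc, ← mul_assoc, sub_mul_strI (by omega), sub_mul_strI (by omega)]
      have e : ((-1 : K)) ^ (m + N + 1) = (-1) ^ (n + N + 1) := strI_even K N ⟨N, by omega⟩
      unfold strI
      rw [e, show 2 * N + 1 - n = m + 1 by omega, show 2 * N + 1 - m = n + 1 by omega,
        Nat.factorial_succ, Nat.factorial_succ]
      push_cast
      ring
    · simp
  · simp [adC, hp.eq_zero m hm, hp.eq_zero (m + 1) (by omega)]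

theorem quadD_comm (hμ : μ ≠ 0) (m : ℕ) :
    quadD N μ p * p m - p m * quadD N μ p = adD K N p m := by
  rcases Nat.lt_or_ge m (2 * N + 2) with hm | hm
  · refine hp.quad_comm hμ (fun n => Submodule.smul_mem _ _ (mem_span_range _)) ?_ hm
    intro m n _ _
    simp only [smul_mul_assoc, mul_smul_comm, ← smul_sub]
    rw [hp.comm, hp.comm, add_comm m n]
    split_ifs with h
    · rw [smul_smul, smul_smul]
      congr 1
      rw [strI_swap K N h]
      have h' : (n : K) + m = 2 * N + 1 := by exact_mod_cast h
      linear_combination (-2 * strI K N n * μ) * h'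
    · simp
  · simp [adD, hp.eq_zero m hm]

/-- The bound on `m` matters here: at `m = 2N+2` the left side is zero while `adH` gives a multiple
of `p (2N+1)`. For `adC` the corresponding coefficient vanishes by itself. -/
theorem quadH_comm (hμ : μ ≠ 0) {m : ℕ} (hm : m < 2 * N + 2) :
    quadH N μ p * p m - p m * quadH N μ p = adH K p m := by
  refine hp.quad_comm hμ (fun n => Submodule.smul_mem _ _ (mem_span_range _)) ?_ hm
  intro m n _ _
  simp only [smul_mul_assoc, mul_smul_comm, ← smul_sub]
  rw [hp.comm, hp.comm]
  rcases n with _ | n <;> rcases m with _ | m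
  · simp
  · simp only [Nat.add_sub_cancel, add_zero]
    by_cases h : m = 2 * N + 1
    · omega
    · simp [h]
  · simp only [Nat.add_sub_cancel, add_zero]
    by_cases h : n = 2 * N + 1
    · omega
    · simp [h]
  · simp only [Nat.add_sub_cancel]
    rw [show m + (n + 1) = n + (m + 1) by ring]
    split_ifs with h
    · rw [smul_smul, smul_smul]
      congr 1
      have e : ((-1 : K)) ^ (m + N + 1) = (-1) ^ (n + N + 1) := strI_even K N ⟨N, by omega⟩
      unfold strI
      rw [e, show 2 * N + 1 - n = m + 1 by omega, show 2 * N + 1 - m = n + 1 by omega,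
        Nat.factorial_succ, Nat.factorial_succ]
      push_cast
      ring
    · simp

omit hp [CharZero K] in
theorem comm_quad_of_comm {t : A} {w : ℕ → A} (ht : ∀ n, t * p n = p n * t)
    (hw : ∀ n, w n ∈ Submodule.span K (Set.range p)) : t * quad N μ p w = quad N μ p w * t := by
  have h : ∀ q ∈ Submodule.span K (Set.range p), t * q = q * t := by
    intro q hq
    induction hq using Submodule.span_induction with
    | mem q hq =>
      obtain ⟨k, rfl⟩ := hq
      exact ht k
    | zero => simp
    | add x y _ _ hx hy => rw [mul_add, add_mul, hx, hy]
    | smul a x _ hx => rw [mul_smul_comm, smul_mul_assoc, hx]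
  unfold quad
  rw [mul_smul_comm, smul_mul_assoc, Finset.sum_mul, Finset.mul_sum]
  congr 1
  refine Finset.sum_congr rfl fun n _ => ?_
  rw [mul_smul_comm, smul_mul_assoc, ← mul_assoc, h _ (hw n), mul_assoc, ht, mul_assoc]

omit hp [CharZero K] in
theorem comm_quadC {t : A} (ht : ∀ n, t * p n = p n * t) : t * quadC N μ p = quadC N μ p * t :=
  comm_quad_of_comm ht fun _ => Submodule.smul_mem _ _ (mem_span_range _)

omit hp [CharZero K] in
theorem comm_quadD {t : A} (ht : ∀ n, t * p n = p n * t) : t * quadD N μ p = quadD N μ p * t :=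
  comm_quad_of_comm ht fun _ => Submodule.smul_mem _ _ (mem_span_range _)

omit hp [CharZero K] in
theorem comm_quadH {t : A} (ht : ∀ n, t * p n = p n * t) : t * quadH N μ p = quadH N μ p * t :=
  comm_quad_of_comm ht fun _ => Submodule.smul_mem _ _ (mem_span_range _)

omit hp [CharZero K] in
theorem comm_quad_of_scale {t : A} {w : ℕ → A} {τ : ℕ → A}
    (ht : ∀ n, t * p n - p n * t = τ n) :
    t * quad N μ p w - quad N μ p w * t = (-(1 / (2 * μ))) • ∑ n ∈ Finset.range (2 * N + 2),
      (strI K N n)⁻¹ • ((t * w n - w n * t) * p (2 * N + 1 - n) + w n * τ (2 * N + 1 - n)) := by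
  unfold quad
  rw [mul_smul_comm, smul_mul_assoc, ← smul_sub, Finset.sum_mul, Finset.mul_sum,
    ← Finset.sum_sub_distrib]
  congr 1
  refine Finset.sum_congr rfl fun n _ => ?_
  rw [mul_smul_comm, smul_mul_assoc, ← smul_sub, ← ht]
  congr 1
  noncomm_ring

-- Each term of `quadH` is a product of eigenvectors of `ad t` whose weights add up to `2`. Only the
-- commutators of `t` with the `p n` enter, so the lemma serves both for `t = quadD` and for the
-- operator `D` of a module; the same holds for the two lemmas that follow.
omit hp [CharZero K] in
theorem adD_comm_quadH {t : A} (ht : ∀ n, t * p n - p n * t = adD K N p n) :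
    t * quadH N μ p - quadH N μ p * t = (2 : K) • quadH N μ p := by
  unfold quadH
  rw [comm_quad_of_scale ht]
  unfold quad
  rw [smul_comm (2 : K) (-(1 / (2 * μ))) (_ : A), Finset.smul_sum (r := (2 : K))]
  congr 1
  refine Finset.sum_congr rfl fun n hn => ?_
  rw [smul_comm (2 : K) _ (_ : A)]
  congr 1
  have hn := Finset.mem_range.mp hn
  rcases n with _ | n
  · simp [adH]
  · unfold adH
    rw [mul_smul_comm, smul_mul_assoc, ← smul_sub, ht]
    unfold adD
    obtain ⟨k, hk⟩ : ∃ k, 2 * N = n + k := ⟨2 * N - n, by omega⟩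
    have hk' : (2 * (N : K)) = n + k := by
      have := congrArg (Nat.cast (R := K)) hk
      push_cast at this
      exact this
    rw [show 2 * N + 1 - (n + 1) = k by omega, hk']
    simp only [smul_mul_assoc, mul_smul_comm, Nat.add_sub_cancel, smul_smul]
    rw [← add_smul]
    congr 1
    push_cast
    ring

omit hp [CharZero K] in
theorem adD_comm_quadC {t : A} (ht : ∀ n, t * p n - p n * t = adD K N p n) :
    t * quadC N μ p - quadC N μ p * t = (-2 : K) • quadC N μ p := by
  unfold quadC
  rw [comm_quad_of_scale ht]
  unfold quad
  rw [smul_comm (-2 : K) (-(1 / (2 * μ))) (_ : A), Finset.smul_sum (r := (-2 : K))]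
  congr 1
  refine Finset.sum_congr rfl fun n hn => ?_
  rw [smul_comm (-2 : K) _ (_ : A)]
  congr 1
  have hn := Finset.mem_range.mp hn
  unfold adC
  rw [mul_smul_comm, smul_mul_assoc, ← smul_sub, ht]
  unfold adD
  obtain ⟨k, hk⟩ : ∃ k, 2 * N + 1 = n + k := ⟨2 * N + 1 - n, by omega⟩
  have hk' : (2 * (N : K) + 1) = n + k := by
    have := congrArg (Nat.cast (R := K)) hk
    push_cast at this
    exact this
  rw [show 2 * N + 1 - n = k by omega, hk']
  simp only [smul_mul_assoc, mul_smul_comm, smul_smul]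
  rw [← add_smul]
  congr 1
  push_cast
  ring

-- Both sides are combinations of the products `p n * p (2N+1-n)`. The product rule also yields
-- terms with index `n - 1`; shifting the summation index and rewriting the structure constants with
-- `sub_mul_strI` merges the two families.
omit hp in
theorem adC_comm_quadH {t : A} (ht : ∀ n, t * p n - p n * t = adC K N p n) :
    t * quadH N μ p - quadH N μ p * t = quadD N μ p := by
  unfold quadH quadD
  rw [comm_quad_of_scale ht]
  unfold quad
  congr 1
  have h1 : ∀ n ∈ Finset.range (2 * N + 2),
      (strI K N n)⁻¹ • ((t * adH K p n - adH K p n * t) * p (2 * N + 1 - n) +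
        adH K p n * adC K N p (2 * N + 1 - n)) =
      (-((n : K) * (2 * N + 2 - n)) * (strI K N n)⁻¹) • (p n * p (2 * N + 1 - n)) +
      (-((n : K) * n) * (strI K N n)⁻¹) • (p (n - 1) * p (2 * N + 1 - (n - 1))) := by
    intro n hn
    have hn := Finset.mem_range.mp hn
    rcases n with _ | n
    · simp [adH]
    · unfold adH
      rw [mul_smul_comm, smul_mul_assoc, ← smul_sub, ht]
      unfold adC
      obtain ⟨k, hk⟩ : ∃ k, 2 * N = n + k := ⟨2 * N - n, by omega⟩
      have hk' : (2 * (N : K)) = n + k := by exact_mod_cast hk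
      rw [Nat.add_sub_cancel, show 2 * N + 1 - (n + 1) = k by omega,
        show 2 * N + 1 - n = k + 1 by omega, hk']
      simp only [smul_mul_assoc, mul_smul_comm, smul_smul, smul_add]
      congr 2 <;> push_cast <;> ring
  rw [Finset.sum_congr rfl h1, Finset.sum_add_distrib, Finset.sum_range_succ' (fun n =>
    (-((n : K) * n) * (strI K N n)⁻¹) • (p (n - 1) * p (2 * N + 1 - (n - 1)))) (2 * N + 1)]
  simp only [Nat.cast_zero, mul_zero, neg_zero, zero_mul, zero_smul, add_zero, Nat.add_sub_cancel]
  -- The sum can be extended by `k = 2N+1` because the factor `2N+1-k` vanishes there.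
  have h2 : ∑ k ∈ Finset.range (2 * N + 1),
      (-(((k + 1 : ℕ) : K) * ((k + 1 : ℕ) : K)) * (strI K N (k + 1))⁻¹) •
        (p k * p (2 * N + 1 - k)) =
      ∑ k ∈ Finset.range (2 * N + 2),
        ((((k : K) + 1) * (2 * N + 1 - k)) * (strI K N k)⁻¹) • (p k * p (2 * N + 1 - k)) := by
    rw [Finset.sum_range_succ _ (2 * N + 1)]
    push_cast
    rw [sub_self, mul_zero, zero_mul, zero_smul, add_zero]
    refine Finset.sum_congr rfl fun k hk => ?_
    congr 1
    have h := sub_mul_strI (K := K) (Finset.mem_range.mp hk)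
    have h3 := strI_ne_zero (K := K) N k
    have h4 := strI_ne_zero (K := K) N (k + 1)
    field_simp
    linear_combination -h
  rw [h2, ← Finset.sum_add_distrib]
  refine Finset.sum_congr rfl fun k _ => ?_
  unfold adD
  rw [← add_smul, smul_mul_assoc, smul_smul]
  congr 1
  ring

end IsHeisenberg

/-! ### Values of the quadratic elements on a vacuum vector -/

section Vacuum

variable {V : Type*} [AddCommGroup V] [Module K V] {N : ℕ} {μ : K} {p : ℕ → Module.End K V}
  (hp : IsHeisenberg N μ p) {v : V} (hv : ∀ n ≤ N, p n v = 0)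

include hp hv

/-- The indices in each nonzero term add up to `2N`, so the factors commute and at least one of them
is an annihilator, with index at most `N`. -/
theorem quadH_vacuum : quadH N μ p v = 0 := by
  unfold quadH quad
  rw [LinearMap.smul_apply, LinearMap.sum_apply, Finset.sum_eq_zero, smul_zero]
  intro n hn
  have hn := Finset.mem_range.mp hn
  rw [LinearMap.smul_apply]
  refine smul_eq_zero_of_right _ ?_
  unfold adH
  rw [smul_mul_assoc, LinearMap.smul_apply]
  rcases Nat.lt_or_ge N n with h | h
  · rw [Module.End.mul_apply, hv _ (by omega), map_zero, smul_zero]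
  · rcases n with _ | n
    · simp
    · rw [hp.comm_of_ne (by omega), Module.End.mul_apply, hv _ (by omega), map_zero, smul_zero]

/-- The normal ordering constant: terms with `n ≤ N` contribute their commutator, the others vanish,
and the odd numbers `2N+1-2n` for `n ≤ N` add up to `(N+1)²`. -/
theorem quadD_vacuum [CharZero K] (hμ : μ ≠ 0) :
    quadD N μ p v = (-(1 / 2 * ((N : K) + 1) ^ 2)) • v := by
  unfold quadD quad
  have h1 : ∀ n ∈ Finset.range (2 * N + 2),
      ((strI K N n)⁻¹ • (adD K N p n * p (2 * N + 1 - n))) v =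
      (if n < N + 1 then μ * (2 * N + 1 - 2 * n) else 0) • v := by
    intro n hn
    have hn := Finset.mem_range.mp hn
    unfold adD
    rw [LinearMap.smul_apply, smul_mul_assoc, LinearMap.smul_apply]
    split_ifs with h
    · have := hp.comm n (2 * N + 1 - n)
      rw [if_pos (by omega), sub_eq_iff_eq_add] at this
      have h3 := strI_ne_zero (K := K) N n
      rw [this, LinearMap.add_apply, Module.End.mul_apply, hv n (by omega), map_zero, add_zero,
        LinearMap.smul_apply, Module.End.one_apply, smul_smul, smul_smul]
      congr 1
      field_simp
    · rw [Module.End.mul_apply, hv (2 * N + 1 - n) (by omega)]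
      simp
  have h2 : ∀ k : ℕ, ∑ n ∈ Finset.range k, (μ * (2 * N + 1 - 2 * (n : K))) =
      μ * (k * (2 * N + 2 - k)) := by
    intro k
    induction k with
    | zero => simp
    | succ k ih =>
      rw [Finset.sum_range_succ, ih]
      push_cast
      ring
  rw [LinearMap.smul_apply, LinearMap.sum_apply, Finset.sum_congr rfl h1, ← Finset.sum_smul,
    ← Finset.sum_filter,
    show (Finset.range (2 * N + 2)).filter (· < N + 1) = Finset.range (N + 1) by
      ext n; simp; omega, h2, smul_smul]
  congr 1
  push_cast
  field_simp
  ring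

/-- The indices in each term add up to `2N+2`. Only `n = N`, with both indices equal to `N+1`,
avoids an annihilator; the constant is `1/(α_ℓ μ)`. -/
theorem quadC_vacuum [CharZero K] (hμ : μ ≠ 0) :
    quadC N μ p v = (2 * (N.factorial : K) ^ 2 * μ)⁻¹ • p (N + 1) (p (N + 1) v) := by
  unfold quadC quad
  rw [LinearMap.smul_apply, LinearMap.sum_apply, Finset.sum_eq_single N]
  · unfold adC strI
    rw [LinearMap.smul_apply, smul_mul_assoc, LinearMap.smul_apply,
      show 2 * N + 1 - N = N + 1 by omega, Module.End.mul_apply, smul_smul, smul_smul]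
    congr 1
    have h1 : (N.factorial : K) ≠ 0 := by exact_mod_cast N.factorial_ne_zero
    have h2 : (N : K) + 1 ≠ 0 := by exact_mod_cast N.succ_ne_zero
    rw [Nat.factorial_succ, Odd.neg_one_pow ⟨N, by ring⟩]
    push_cast
    rw [show 2 * (N : K) + 1 - N = N + 1 by ring]
    field_simp
  · intro n hn hne
    have hn := Finset.mem_range.mp hn
    unfold adC
    rw [LinearMap.smul_apply, smul_mul_assoc, LinearMap.smul_apply]
    rcases Nat.lt_or_ge N n with h | h
    · rw [Module.End.mul_apply, hv _ (by omega), map_zero, smul_zero, smul_zero]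
    · rw [hp.comm_of_ne (by omega), Module.End.mul_apply, hv _ (by omega), map_zero, smul_zero,
        smul_zero]
  · intro h
    exact absurd (Finset.mem_range.mpr (by omega)) h

end Vacuum

end Heisenberg

attribute [local instance 100] LieRing.ofAssociativeRing

/-! ### The oscillator representation twisted by a commuting `sl₂` -/

section OscillatorRep

variable {K : Type*} [Field K] {A : Type*} [Ring A] [Algebra K A]

/-- An `sl₂`-triple commuting with a Heisenberg family. -/
structure IsHeisenbergSl2 (N : ℕ) (μ : K) (p : ℕ → A) (c d h : A) : Prop
    extends IsHeisenberg N μ p where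
  c_comm : ∀ n, c * p n = p n * c
  d_comm : ∀ n, d * p n = p n * d
  h_comm : ∀ n, h * p n = p n * h
  d_h : d * h - h * d = (2 : K) • h
  d_c : d * c - c * d = (-2 : K) • c
  c_h : c * h - h * c = d

/-- The images of the basis vectors under the representation built from a Heisenberg family and a
commuting `sl₂`-triple. -/
noncomputable def oscGen (N : ℕ) (μ : K) (p : ℕ → A) (c d h : A) : Gen N → A
  | .C => c + quadC N μ p
  | .D => d + quadD N μ p
  | .H => h + quadH N μ p
  | .M => algebraMap K A μ
  | .P n => p n

/-- The linear extension of `oscGen`. -/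
noncomputable def oscLin (N : ℕ) (μ : K) (p : ℕ → A) (c d h : A) : Alg K N →ₗ[K] A :=
  (genBasis K N).constr K (oscGen N μ p c d h)

theorem oscLin_gen (N : ℕ) (μ : K) (p : ℕ → A) (c d h : A) (i : Gen N) :
    oscLin N μ p c d h (gen K i) = oscGen N μ p c d h i := by
  simp only [oscLin, gen, Module.Basis.constr_basis]

theorem oscLin_C (N : ℕ) (μ : K) (p : ℕ → A) (c d h : A) :
    oscLin N μ p c d h (C K N) = c + quadC N μ p := oscLin_gen _ _ _ _ _ _ _

theorem oscLin_D (N : ℕ) (μ : K) (p : ℕ → A) (c d h : A) :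
    oscLin N μ p c d h (D K N) = d + quadD N μ p := oscLin_gen _ _ _ _ _ _ _

theorem oscLin_H (N : ℕ) (μ : K) (p : ℕ → A) (c d h : A) :
    oscLin N μ p c d h (H K N) = h + quadH N μ p := oscLin_gen _ _ _ _ _ _ _

theorem oscLin_M (N : ℕ) (μ : K) (p : ℕ → A) (c d h : A) :
    oscLin N μ p c d h (M K N) = algebraMap K A μ := oscLin_gen _ _ _ _ _ _ _

variable {N : ℕ} {μ : K} {p : ℕ → A} {c d h : A}

theorem oscLin_P (hp : IsHeisenberg N μ p) (n : ℕ) : oscLin N μ p c d h (P K N n) = p n := by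
  unfold P
  split_ifs with hn
  · exact oscLin_gen _ _ _ _ _ _ _
  · rw [map_zero, hp.eq_zero n (by omega)]

namespace IsHeisenbergSl2

variable [CharZero K]

/-- The triple commutes with the `p n`, hence with the quadratic elements, so each bracket of sums
splits into the bracket of the triple plus that of the quadratic elements, and both obey the same
relations. -/
theorem oscGen_comm (hμ : μ ≠ 0) (hs : IsHeisenbergSl2 N μ p c d h) (i j : Gen N) :
    oscLin N μ p c d h (br K N i j) =
      oscGen N μ p c d h i * oscGen N μ p c d h j -
        oscGen N μ p c d h j * oscGen N μ p c d h i := by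
  have hp := hs.toIsHeisenberg
  have qC := hp.quadC_comm hμ
  have qD := hp.quadD_comm hμ
  have CP : ∀ n, (c + quadC N μ p) * p n - p n * (c + quadC N μ p) =
      (2 * (N : K) + 1 - n) • p (n + 1) := by
    intro n
    rw [add_mul, mul_add, hs.c_comm, add_sub_add_left_eq_sub, qC]
    rfl
  have DP : ∀ n, (d + quadD N μ p) * p n - p n * (d + quadD N μ p) =
      (2 * (N : K) + 1 - 2 * n) • p n := by
    intro n
    rw [add_mul, mul_add, hs.d_comm, add_sub_add_left_eq_sub, qD]
    rfl
  have HP : ∀ n < 2 * N + 2, (h + quadH N μ p) * p n - p n * (h + quadH N μ p) =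
      (-(n : K)) • p (n - 1) := by
    intro n hn
    rw [add_mul, mul_add, hs.h_comm, add_sub_add_left_eq_sub, hp.quadH_comm hμ hn]
    rfl
  have expand : ∀ {x y X Y : A}, x * Y = Y * x → y * X = X * y →
      (x + X) * (y + Y) - (y + Y) * (x + X) = (x * y - y * x) + (X * Y - Y * X) := by
    intro x y X Y h1 h2
    rw [add_mul, add_mul, mul_add, mul_add, mul_add, mul_add, h1, h2]
    abel
  have CH : (c + quadC N μ p) * (h + quadH N μ p) - (h + quadH N μ p) * (c + quadC N μ p) =
      d + quadD N μ p := by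
    rw [expand (IsHeisenberg.comm_quadH hs.c_comm) (IsHeisenberg.comm_quadC hs.h_comm), hs.c_h,
      IsHeisenberg.adC_comm_quadH qC]
  have DH : (d + quadD N μ p) * (h + quadH N μ p) - (h + quadH N μ p) * (d + quadD N μ p) =
      (2 : K) • (h + quadH N μ p) := by
    rw [expand (IsHeisenberg.comm_quadH hs.d_comm) (IsHeisenberg.comm_quadD hs.h_comm), hs.d_h,
      IsHeisenberg.adD_comm_quadH qD, smul_add]
  have DC : (d + quadD N μ p) * (c + quadC N μ p) - (c + quadC N μ p) * (d + quadD N μ p) =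
      (-2 : K) • (c + quadC N μ p) := by
    rw [expand (IsHeisenberg.comm_quadC hs.d_comm) (IsHeisenberg.comm_quadD hs.c_comm), hs.d_c,
      IsHeisenberg.adD_comm_quadC qD, smul_add]
  cases i <;> cases j <;>
    simp only [br, oscGen, map_neg, map_smul, map_zero, oscLin_C, oscLin_D, oscLin_H,
      oscLin_P hp, Algebra.commutes, sub_self, ← CH, ← DH, ← DC, ← CP, ← DP, neg_sub]
  · exact (HP _ (Fin.is_lt _)).symm
  · rw [← HP _ (Fin.is_lt _), neg_sub]
  · rw [hp.comm]
    split_ifs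
    · rw [map_smul, oscLin_M, Algebra.algebraMap_eq_smul_one, smul_smul]
    · simp

/-- The representation built from a Heisenberg family and a commuting `sl₂`-triple. -/
noncomputable def oscRep (hμ : μ ≠ 0) (hs : IsHeisenbergSl2 N μ p c d h) : Alg K N →ₗ⁅K⁆ A where
  toLinearMap := oscLin N μ p c d h
  map_lie' {x y} := by
    have key : (brL K N).compr₂ (oscLin N μ p c d h) =
        (LinearMap.mul K A).compl₁₂ (oscLin N μ p c d h) (oscLin N μ p c d h) -
        ((LinearMap.mul K A).compl₁₂ (oscLin N μ p c d h) (oscLin N μ p c d h)).flip := by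
      refine alg_hom_ext fun i => alg_hom_ext fun j => ?_
      simp only [LinearMap.compr₂_apply, brL_gen, LinearMap.sub_apply, LinearMap.compl₁₂_apply,
        LinearMap.flip_apply, LinearMap.mul_apply', oscLin_gen]
      exact hs.oscGen_comm hμ i j
    exact congrArg (fun f => f x y) key

end IsHeisenbergSl2

end OscillatorRep

/-! ### The polynomial model -/

section Fock

variable (K : Type*) [Field K] (N : ℕ)

/-- The polynomial ring on which the Verma module is realized. The variable `none` corresponds to
`C` and the variable `some i` to `P_{N+1+i}`. -/
abbrev Fock : Type _ := MvPolynomial (Option (Fin (N + 1))) K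

variable {K N}

/-- Multiplication by a variable. -/
noncomputable def mulX (i : Option (Fin (N + 1))) : Module.End K (Fock K N) :=
  LinearMap.mulLeft K (MvPolynomial.X i)

/-- Partial differentiation. -/
noncomputable def diffX (i : Option (Fin (N + 1))) : Module.End K (Fock K N) :=
  (MvPolynomial.pderiv i).toLinearMap

theorem mulX_apply (i : Option (Fin (N + 1))) (f : Fock K N) :
    mulX i f = MvPolynomial.X i * f := rfl

theorem diffX_apply (i : Option (Fin (N + 1))) (f : Fock K N) :
    diffX i f = MvPolynomial.pderiv i f := rfl

theorem smul_mul_sub_mul_smul {R : Type*} [Ring R] [Algebra K R] (a : K) (x y : R) :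
    (a • x) * y - y * (a • x) = a • (x * y - y * x) := by
  rw [mul_smul_comm, smul_mul_assoc, smul_sub]

theorem mul_smul_sub_smul_mul {R : Type*} [Ring R] [Algebra K R] (a : K) (x y : R) :
    x * (a • y) - (a • y) * x = a • (x * y - y * x) := by
  rw [mul_smul_comm, smul_mul_assoc, smul_sub]

theorem mulX_comm (i j : Option (Fin (N + 1))) :
    (mulX i * mulX j : Module.End K (Fock K N)) = mulX j * mulX i := by
  refine LinearMap.ext fun f => ?_
  simp only [Module.End.mul_apply, mulX_apply]
  ring

theorem diffX_comm (i j : Option (Fin (N + 1))) :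
    (diffX i * diffX j : Module.End K (Fock K N)) = diffX j * diffX i := by
  have h : ⁅MvPolynomial.pderiv (R := K) i, MvPolynomial.pderiv (R := K) j⁆ = 0 := by
    refine MvPolynomial.derivation_ext fun k => ?_
    rw [Derivation.commutator_apply]
    simp only [MvPolynomial.pderiv_X, Pi.single_apply]
    split_ifs <;> simp
  refine LinearMap.ext fun f => ?_
  have := congrArg (fun D : Derivation K (Fock K N) (Fock K N) => D f) h
  rw [Derivation.commutator_apply] at this
  exact sub_eq_zero.mp this

theorem diffX_mulX (i j : Option (Fin (N + 1))) :
    (diffX i * mulX j - mulX j * diffX i : Module.End K (Fock K N)) = if i = j then 1 else 0 := by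
  refine LinearMap.ext fun f => ?_
  simp only [Module.End.mul_apply, mulX_apply, diffX_apply, LinearMap.sub_apply,
    MvPolynomial.pderiv_mul, MvPolynomial.pderiv_X, Pi.single_apply]
  split_ifs with h1 h2 h2
  · simp
  · exact absurd h1.symm h2
  · exact absurd h2.symm h1
  · simp

theorem diffX_mulX_of_ne {i j : Option (Fin (N + 1))} (h : i ≠ j) :
    (diffX i * mulX j : Module.End K (Fock K N)) = mulX j * diffX i := by
  have := diffX_mulX (K := K) i j
  rwa [if_neg h, sub_eq_zero] at this

/-- The action of `P_n` on the polynomial ring. -/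
noncomputable def fockP (μ : K) (n : ℕ) : Module.End K (Fock K N) :=
  if n ≤ N then (strI K N n * μ) • diffX (some (Fin.ofNat (N + 1) (N - n)))
  else if n < 2 * N + 2 then mulX (some (Fin.ofNat (N + 1) (n - (N + 1)))) else 0

theorem fockP_of_le (μ : K) {n : ℕ} (h : n ≤ N) :
    (fockP μ n : Module.End K (Fock K N)) =
      -- The derivative index is `N - n = (2N+1-n) - (N+1)`, that of the variable representing the
      -- conjugate `P_{2N+1-n}`.
      (strI K N n * μ) • diffX (some (Fin.ofNat (N + 1) (N - n))) := if_pos h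

theorem fockP_of_gt (μ : K) {n : ℕ} (h : N < n) (h' : n < 2 * N + 2) :
    (fockP μ n : Module.End K (Fock K N)) =
      mulX (some (Fin.ofNat (N + 1) (n - (N + 1)))) := by
  unfold fockP
  rw [if_neg (by omega), if_pos h']

theorem fockP_of_ge (μ : K) {n : ℕ} (h : 2 * N + 2 ≤ n) :
    (fockP μ n : Module.End K (Fock K N)) = 0 := by
  unfold fockP
  rw [if_neg (by omega), if_neg (by omega)]

theorem comm_fockP {t : Module.End K (Fock K N)}
    (h1 : ∀ i, t * diffX (some i) = diffX (some i) * t)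
    (h2 : ∀ i, t * mulX (some i) = mulX (some i) * t) (μ : K) (n : ℕ) :
    t * fockP μ n = fockP μ n * t := by
  unfold fockP
  split_ifs
  · rw [mul_smul_comm, smul_mul_assoc, h1]
  · exact h2 _
  · simp

theorem ofNat_inj_of_lt {a b : ℕ} (ha : a < N + 1) (hb : b < N + 1) :
    (some (Fin.ofNat (N + 1) a) = some (Fin.ofNat (N + 1) b)) ↔ a = b := by
  rw [Option.some_inj, Fin.ext_iff]
  simp [Fin.ofNat, Nat.mod_eq_of_lt ha, Nat.mod_eq_of_lt hb]

theorem fockP_heisenberg (μ : K) : IsHeisenberg N μ (fockP (N := N) μ) where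
  eq_zero n h := fockP_of_ge μ h
  comm m n := by
    rcases Nat.lt_or_ge m (2 * N + 2) with hm | hm
    swap
    · rw [fockP_of_ge μ hm, if_neg (by omega)]
      simp
    rcases Nat.lt_or_ge n (2 * N + 2) with hn | hn
    swap
    · rw [fockP_of_ge μ hn, if_neg (by omega)]
      simp
    rcases Nat.lt_or_ge N m with hm' | hm' <;> rcases Nat.lt_or_ge N n with hn' | hn'
    · rw [fockP_of_gt μ hm' hm, fockP_of_gt μ hn' hn, if_neg (by omega), mulX_comm, sub_self]
    · rw [fockP_of_gt μ hm' hm, fockP_of_le μ hn']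
      refine (mul_smul_sub_smul_mul _ _ _).trans ?_
      rw [← neg_sub, diffX_mulX]
      simp only [ofNat_inj_of_lt (show N - n < N + 1 by omega)
        (show m - (N + 1) < N + 1 by omega)]
      by_cases h : m + n = 2 * N + 1
      · rw [if_pos (by omega), if_pos h, strI_swap K N h]
        module
      · rw [if_neg (by omega), if_neg h]
        simp
    · rw [fockP_of_gt μ hn' hn, fockP_of_le μ hm']
      refine (smul_mul_sub_mul_smul _ _ _).trans ?_
      rw [diffX_mulX]
      simp only [ofNat_inj_of_lt (show N - m < N + 1 by omega)
        (show n - (N + 1) < N + 1 by omega)]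
      by_cases h : m + n = 2 * N + 1
      · rw [if_pos (by omega), if_pos h]
      · rw [if_neg (by omega), if_neg h]
        simp
    · rw [fockP_of_le μ hm', fockP_of_le μ hn', if_neg (by omega), mul_smul_comm, smul_mul_assoc,
        mul_smul_comm, smul_mul_assoc, diffX_comm, smul_comm, sub_self]

/-- The `D`-part of the `sl₂`-triple acting on the variable `none`. -/
noncomputable def fockD (lam : K) : Module.End K (Fock K N) :=
  lam • 1 - (2 : K) • (mulX none * diffX none)

/-- The `H`-part of the `sl₂`-triple acting on the variable `none`. -/
noncomputable def fockH (lam : K) : Module.End K (Fock K N) :=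
  mulX none * (diffX none * diffX none) - lam • diffX none

/-- The triple involves only the variable `none`, the Weyl algebra only the variables `some i`. The
`sl₂` relations are checked by moving derivatives to the right of multiplications with `∂x = x∂ +
1`. -/
theorem fock_sl2 (μ lam : K) :
    IsHeisenbergSl2 N μ (fockP (N := N) μ) (mulX none) (fockD lam) (fockH lam) where
  toIsHeisenberg := fockP_heisenberg μ
  c_comm := comm_fockP (fun i => (diffX_mulX_of_ne (by simp)).symm) (fun i => mulX_comm _ _) μ
  d_comm := by
    refine comm_fockP (fun i => ?_) (fun i => ?_) μ
    · have h1 := diffX_mulX_of_ne (K := K) (show some i ≠ none by simp)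
      have h2 := diffX_comm (K := K) (some i) none
      simp only [fockD, sub_mul, mul_sub, smul_mul_assoc, mul_smul_comm, one_mul, mul_one]
      rw [mul_assoc, ← h2, ← mul_assoc, ← h1, mul_assoc]
    · have h1 := diffX_mulX_of_ne (K := K) (show none ≠ some i by simp)
      have h2 := mulX_comm (K := K) (some i) none
      simp only [fockD, sub_mul, mul_sub, smul_mul_assoc, mul_smul_comm, one_mul, mul_one]
      rw [mul_assoc, h1, ← mul_assoc, ← h2, mul_assoc]
  h_comm := by
    refine comm_fockP (fun i => ?_) (fun i => ?_) μ
    · have h1 := diffX_mulX_of_ne (K := K) (show some i ≠ none by simp)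
      have h2 := diffX_comm (K := K) (some i) none
      simp only [fockH, sub_mul, mul_sub, smul_mul_assoc, mul_smul_comm]
      rw [mul_assoc, mul_assoc, ← h2, ← mul_assoc (diffX none), ← h2, mul_assoc, ← mul_assoc,
        ← h1, mul_assoc]
    · have h1 := diffX_mulX_of_ne (K := K) (show none ≠ some i by simp)
      have h2 := mulX_comm (K := K) (some i) none
      simp only [fockH, sub_mul, mul_sub, smul_mul_assoc, mul_smul_comm]
      rw [mul_assoc, mul_assoc, h1, ← mul_assoc (diffX none), h1, mul_assoc, ← mul_assoc,
        ← h2, mul_assoc]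
  d_h := by
    have h1 := diffX_mulX (K := K) (N := N) none none
    rw [if_pos rfl, sub_eq_iff_eq_add] at h1
    have h2 : ∀ z : Module.End K (Fock K N),
        diffX none * (mulX none * z) = z + mulX none * (diffX none * z) := by
      intro z
      rw [← mul_assoc, h1, add_mul, one_mul, mul_assoc]
    simp only [fockD, fockH, sub_mul, mul_sub, smul_mul_assoc, mul_smul_comm, one_mul, mul_one,
      mul_assoc, h2, mul_add]
    module
  d_c := by
    have h1 := diffX_mulX (K := K) (N := N) none none
    rw [if_pos rfl, sub_eq_iff_eq_add] at h1
    simp only [fockD, sub_mul, mul_sub, smul_mul_assoc, mul_smul_comm, one_mul, mul_one,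
      mul_assoc, h1, mul_add]
    module
  c_h := by
    have h1 := diffX_mulX (K := K) (N := N) none none
    rw [if_pos rfl, sub_eq_iff_eq_add] at h1
    have h2 : ∀ z : Module.End K (Fock K N),
        diffX none * (mulX none * z) = z + mulX none * (diffX none * z) := by
      intro z
      rw [← mul_assoc, h1, add_mul, one_mul, mul_assoc]
    simp only [fockD, fockH, sub_mul, mul_sub, smul_mul_assoc, mul_smul_comm, mul_one,
      mul_assoc, h1, h2, mul_add]
    module

end Fock

/-! ### Maps out of the polynomial model -/

section Intertwining

variable {K : Type*} [Field K]

/-- Although `A` is noncommutative, the subalgebra generated by the range of `f` is commutative, so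
polynomial evaluation can be carried out there. -/
theorem exists_algHom_of_commute {σ A : Type*} [Ring A] [Algebra K A] (f : σ → A)
    (hf : ∀ i j, f i * f j = f j * f i) :
    ∃ θ : MvPolynomial σ K →ₐ[K] A, ∀ i, θ (MvPolynomial.X i) = f i := by
  have hc : ∀ a ∈ Set.range f, ∀ b ∈ Set.range f, a * b = b * a := by
    rintro _ ⟨i, rfl⟩ _ ⟨j, rfl⟩
    exact hf i j
  have hm := Algebra.isMulCommutative_adjoin K hc
  let _ : CommRing (Algebra.adjoin K (Set.range f)) :=
    { (inferInstance : Ring (Algebra.adjoin K (Set.range f))) with mul_comm := hm.is_comm.comm }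
  refine ⟨(Algebra.adjoin K (Set.range f)).val.comp
    (MvPolynomial.aeval (R := K) (S₁ := Algebra.adjoin K (Set.range f))
      fun i => ⟨f i, Algebra.subset_adjoin ⟨i, rfl⟩⟩), fun i => ?_⟩
  rw [AlgHom.comp_apply, MvPolynomial.aeval_X]
  rfl

variable {V : Type*} [AddCommGroup V] [Module K V] {N : ℕ}

/-- `Ψ` intertwines `T₀` and `T`. -/
def Intertwines (Ψ : Fock K N →ₗ[K] V) (T₀ : Module.End K (Fock K N)) (T : Module.End K V) : Prop :=
  ∀ f, Ψ (T₀ f) = T (Ψ f)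

namespace Intertwines

variable {Ψ : Fock K N →ₗ[K] V} {S₀ T₀ : Module.End K (Fock K N)} {S T : Module.End K V}

theorem zero : Intertwines Ψ 0 0 := fun f => by simp

theorem one : Intertwines Ψ 1 1 := fun f => by simp

theorem add (hS : Intertwines Ψ S₀ S) (hT : Intertwines Ψ T₀ T) :
    Intertwines Ψ (S₀ + T₀) (S + T) := fun f => by simp [hS f, hT f]

theorem smul (a : K) (hT : Intertwines Ψ T₀ T) : Intertwines Ψ (a • T₀) (a • T) :=
  fun f => by simp [hT f]

theorem mul (hS : Intertwines Ψ S₀ S) (hT : Intertwines Ψ T₀ T) :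
    Intertwines Ψ (S₀ * T₀) (S * T) := fun f => by simp [hS _, hT f]

theorem sum {ι : Type*} (s : Finset ι) {F₀ : ι → Module.End K (Fock K N)} {F : ι → Module.End K V}
    (h : ∀ i ∈ s, Intertwines Ψ (F₀ i) (F i)) : Intertwines Ψ (∑ i ∈ s, F₀ i) (∑ i ∈ s, F i) := by
  intro f
  simp only [LinearMap.sum_apply, map_sum]
  exact Finset.sum_congr rfl fun i hi => h i hi f

theorem quad {μ : K} {p₀ w₀ : ℕ → Module.End K (Fock K N)} {p w : ℕ → Module.End K V}
    (hp : ∀ n, Intertwines Ψ (p₀ n) (p n)) (hw : ∀ n, Intertwines Ψ (w₀ n) (w n)) :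
    Intertwines Ψ (CGA.quad N μ p₀ w₀) (CGA.quad N μ p w) :=
  smul _ (sum _ fun n _ => smul _ ((hw n).mul (hp _)))

/-- Building a polynomial one variable at a time, `T` moves past that variable at the cost of a
commutator, which is already known to intertwine; at the end `T` acts on `1`. -/
theorem of_comm {x : Option (Fin (N + 1)) → Module.End K V}
    (hx : ∀ i, Intertwines Ψ (mulX i) (x i)) (h1 : Ψ (T₀ 1) = T (Ψ 1))
    (h : ∀ i, ∃ S₀ S, Intertwines Ψ S₀ S ∧ T₀ * mulX i - mulX i * T₀ = S₀ ∧
      T * x i - x i * T = S) : Intertwines Ψ T₀ T := by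
  intro f
  induction f using MvPolynomial.induction_on with
  | C a =>
    rw [MvPolynomial.C_eq_smul_one]
    simp only [map_smul, h1]
  | add f g hf hg => simp only [map_add, hf, hg]
  | mul_X f i hf =>
    obtain ⟨S₀, S, hS, e₀, e⟩ := h i
    rw [mul_comm, ← mulX_apply]
    have e₁ := LinearMap.congr_fun e₀ f
    have e₂ := LinearMap.congr_fun e (Ψ f)
    simp only [LinearMap.sub_apply, Module.End.mul_apply] at e₁ e₂
    rw [sub_eq_iff_eq_add.mp e₁, hx i, sub_eq_iff_eq_add.mp e₂, map_add, hS, hx i, hf]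

end Intertwines

theorem mulX_some (μ : K) (i : Fin (N + 1)) : mulX (K := K) (some i) = fockP μ (N + 1 + i) := by
  rw [fockP_of_gt μ (by omega) (by omega), Nat.add_sub_cancel_left]
  congr 2
  ext
  simp [Fin.ofNat, Nat.mod_eq_of_lt i.2]

/-- The universal property of the model: `Ψ` evaluates a polynomial at the commuting operators `c, p
(N+1), …, p (2N+1)` and applies the result to `v`. Multiplications intertwine by construction, the
other operators by `of_comm`. -/
theorem exists_intertwiner {μ lam : K} {p : ℕ → Module.End K V} {c d h : Module.End K V}
    (hs : IsHeisenbergSl2 N μ p c d h) {v : V} (hp : ∀ n ≤ N, p n v = 0) (hd : d v = lam • v)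
    (hh : h v = 0) :
    ∃ Ψ : Fock K N →ₗ[K] V, Ψ 1 = v ∧ (∀ n, Intertwines Ψ (fockP μ n) (p n)) ∧
      Intertwines Ψ (mulX none) c ∧ Intertwines Ψ (fockD lam) d ∧ Intertwines Ψ (fockH lam) h := by
  have h0 := fock_sl2 (N := N) μ lam
  set x : Option (Fin (N + 1)) → Module.End K V := fun i => i.elim c fun i => p (N + 1 + i) with hx
  obtain ⟨θ, hθ⟩ := exists_algHom_of_commute (K := K) x (by
    rintro (_ | i) (_ | j)
    · rfl
    · exact hs.c_comm _
    · exact (hs.c_comm _).symm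
    · exact hs.comm_of_ne (by omega))
  set Ψ : Fock K N →ₗ[K] V := (LinearMap.applyₗ v).comp θ.toLinearMap with hΨ
  have hΨ1 : Ψ 1 = v := by simp [hΨ]
  have hX : ∀ i, Intertwines Ψ (mulX i) (x i) := by
    intro i f
    simp [hΨ, mulX_apply, hθ]
  have hP : ∀ n, Intertwines Ψ (fockP μ n) (p n) := by
    intro n
    rcases Nat.lt_or_ge n (2 * N + 2) with hn | hn
    swap
    · rw [fockP_of_ge μ hn, hs.eq_zero n hn]
      exact Intertwines.zero
    rcases Nat.lt_or_ge N n with hn' | hn'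
    · have h1 := hX (some ⟨n - (N + 1), by omega⟩)
      rw [mulX_some μ] at h1
      simpa only [hx, Option.elim_some, Nat.add_sub_cancel' hn'] using h1
    · refine Intertwines.of_comm hX ?_ ?_
      · rw [fockP_of_le μ hn', hΨ1, hp n hn', LinearMap.smul_apply, diffX_apply,
          MvPolynomial.pderiv_one, smul_zero, map_zero]
      · rintro (_ | i)
        · refine ⟨0, 0, Intertwines.zero, ?_, ?_⟩
          · rw [h0.c_comm, sub_self]
          · simp only [hx, Option.elim_none]
            rw [hs.c_comm, sub_self]
        · refine ⟨_, _, ?_, mulX_some μ i ▸ h0.comm n (N + 1 + i), hs.comm n (N + 1 + i)⟩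
          · split_ifs
            · exact Intertwines.one.smul _
            · exact Intertwines.zero
  have hD : Intertwines Ψ (fockD lam) d := by
    refine Intertwines.of_comm hX ?_ ?_
    · rw [hΨ1, hd, fockD, LinearMap.sub_apply, LinearMap.smul_apply, LinearMap.smul_apply,
        Module.End.mul_apply, diffX_apply, MvPolynomial.pderiv_one, map_zero, smul_zero, sub_zero,
        map_smul, Module.End.one_apply, hΨ1]
    · rintro (_ | i)
      · exact ⟨_, _, (hX none).smul _, h0.d_c, hs.d_c⟩
      · refine ⟨0, 0, Intertwines.zero, ?_, ?_⟩
        · rw [mulX_some μ, h0.d_comm, sub_self]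
        · simp only [hx, Option.elim_some]
          rw [hs.d_comm, sub_self]
  have hH : Intertwines Ψ (fockH lam) h := by
    refine Intertwines.of_comm hX ?_ ?_
    · rw [hΨ1, hh, fockH, LinearMap.sub_apply, LinearMap.smul_apply, Module.End.mul_apply,
        Module.End.mul_apply, diffX_apply none 1, MvPolynomial.pderiv_one, map_zero, map_zero,
        smul_zero, sub_zero, map_zero]
    · rintro (_ | i)
      -- Since `[h, c] = -d`, the intertwining of `h` rests on that of `d`, proved just before.
      · refine ⟨(-1 : K) • fockD lam, (-1 : K) • d, hD.smul _, ?_, ?_⟩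
        · rw [← h0.c_h]
          module
        · rw [← hs.c_h]
          simp only [hx, Option.elim_none]
          module
      · refine ⟨0, 0, Intertwines.zero, ?_, ?_⟩
        · rw [mulX_some μ, h0.h_comm, sub_self]
        · simp only [hx, Option.elim_some]
          rw [hs.h_comm, sub_self]
  exact ⟨Ψ, hΨ1, hP, hX none, hD, hH⟩

end Intertwining

/-! ### Splitting off `sl₂` in a module, and the polynomial module -/

section Modules

variable {K : Type*} [Field K] [CharZero K] {N : ℕ}

section General

variable {W : Type*} [AddCommGroup W] [Module K W] [LieRingModule (Alg K N) W]
  [LieModule K (Alg K N) W]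

variable (K N W) in
/-- The operators `P_n` on a module. -/
noncomputable def opP (n : ℕ) : Module.End K W := LieModule.toEnd K (Alg K N) W (P K N n)

theorem toEnd_comm (x y : Alg K N) :
    LieModule.toEnd K (Alg K N) W x * LieModule.toEnd K (Alg K N) W y -
      LieModule.toEnd K (Alg K N) W y * LieModule.toEnd K (Alg K N) W x =
      LieModule.toEnd K (Alg K N) W (brL K N x y) := by
  rw [← lie_def, LieHom.map_lie]
  rfl

theorem opP_heisenberg {μ : K} (hM : ∀ w : W, ⁅M K N, w⁆ = μ • w) :
    IsHeisenberg N μ (opP K N W) where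
  eq_zero n hn := by
    unfold opP P
    rw [dif_neg (by omega), map_zero]
  comm m n := by
    unfold opP
    rw [toEnd_comm, brL_P]
    split_ifs
    · ext w
      simp [hM, smul_smul]
    · simp

/-- `C` and `quadC` have the same commutators with all `P_n`, so their difference commutes with
them; likewise for `D` and `H`. For the triple, `h = H - quadH` commutes with `quadD`, so `[d, h] =
[D, h] = [D, H] - [D, quadH] = 2 h`; the other two relations follow in the same way. -/
theorem exists_sl2 {μ : K} (hμ : μ ≠ 0) (hM : ∀ w : W, ⁅M K N, w⁆ = μ • w) :
    IsHeisenbergSl2 N μ (opP K N W)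
      (LieModule.toEnd K (Alg K N) W (C K N) - quadC N μ (opP K N W))
      (LieModule.toEnd K (Alg K N) W (D K N) - quadD N μ (opP K N W))
      (LieModule.toEnd K (Alg K N) W (H K N) - quadH N μ (opP K N W)) := by
  have hp := opP_heisenberg hM
  have aC : ∀ n, LieModule.toEnd K (Alg K N) W (C K N) * opP K N W n -
      opP K N W n * LieModule.toEnd K (Alg K N) W (C K N) = adC K N (opP K N W) n := by
    intro n
    unfold opP
    rw [toEnd_comm, brL_C_P, map_smul]
    rfl
  have aD : ∀ n, LieModule.toEnd K (Alg K N) W (D K N) * opP K N W n -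
      opP K N W n * LieModule.toEnd K (Alg K N) W (D K N) = adD K N (opP K N W) n := by
    intro n
    unfold opP
    rw [toEnd_comm, brL_D_P, map_smul]
    rfl
  have aH : ∀ n < 2 * N + 2, LieModule.toEnd K (Alg K N) W (H K N) * opP K N W n -
      opP K N W n * LieModule.toEnd K (Alg K N) W (H K N) = adH K (opP K N W) n := by
    intro n hn
    unfold opP
    rw [toEnd_comm, brL_H_P K N hn, map_smul]
    rfl
  have cC : ∀ n, (LieModule.toEnd K (Alg K N) W (C K N) - quadC N μ (opP K N W)) *
      opP K N W n = opP K N W n *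
      (LieModule.toEnd K (Alg K N) W (C K N) - quadC N μ (opP K N W)) := by
    intro n
    rw [← sub_eq_zero, sub_mul, mul_sub, sub_sub_sub_comm, aC, hp.quadC_comm hμ, sub_self]
  have cD : ∀ n, (LieModule.toEnd K (Alg K N) W (D K N) - quadD N μ (opP K N W)) *
      opP K N W n = opP K N W n *
      (LieModule.toEnd K (Alg K N) W (D K N) - quadD N μ (opP K N W)) := by
    intro n
    rw [← sub_eq_zero, sub_mul, mul_sub, sub_sub_sub_comm, aD, hp.quadD_comm hμ, sub_self]
  have cH : ∀ n, (LieModule.toEnd K (Alg K N) W (H K N) - quadH N μ (opP K N W)) *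
      opP K N W n = opP K N W n *
      (LieModule.toEnd K (Alg K N) W (H K N) - quadH N μ (opP K N W)) := by
    intro n
    rcases Nat.lt_or_ge n (2 * N + 2) with hn | hn
    · rw [← sub_eq_zero, sub_mul, mul_sub, sub_sub_sub_comm, aH n hn, hp.quadH_comm hμ hn, sub_self]
    · rw [hp.eq_zero n hn, mul_zero, zero_mul]
  refine { toIsHeisenberg := hp, c_comm := cC, d_comm := cD, h_comm := cH,
           d_h := ?_, d_c := ?_, c_h := ?_ }
  · have e := IsHeisenberg.comm_quadD (N := N) (μ := μ) cH
    rw [sub_mul, mul_sub _ _ (quadD N μ (opP K N W)), ← e, sub_sub_sub_cancel_right, mul_sub,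
      sub_mul, sub_sub_sub_comm, toEnd_comm, brL_D_H, map_smul, IsHeisenberg.adD_comm_quadH aD,
      smul_sub]
  · have e := IsHeisenberg.comm_quadD (N := N) (μ := μ) cC
    rw [sub_mul, mul_sub _ _ (quadD N μ (opP K N W)), ← e, sub_sub_sub_cancel_right, mul_sub,
      sub_mul, sub_sub_sub_comm, toEnd_comm, brL_D_C, map_smul, IsHeisenberg.adD_comm_quadC aD,
      smul_sub]
  · have e := IsHeisenberg.comm_quadC (N := N) (μ := μ) cH
    rw [sub_mul, mul_sub _ _ (quadC N μ (opP K N W)), ← e, sub_sub_sub_cancel_right, mul_sub,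
      sub_mul, sub_sub_sub_comm, toEnd_comm, brL_C_H, IsHeisenberg.adC_comm_quadH aC]

theorem toEnd_eq_oscLin {μ : K} (hM : ∀ w : W, ⁅M K N, w⁆ = μ • w) (x : Alg K N) :
    LieModule.toEnd K (Alg K N) W x = oscLin N μ (opP K N W)
      (LieModule.toEnd K (Alg K N) W (C K N) - quadC N μ (opP K N W))
      (LieModule.toEnd K (Alg K N) W (D K N) - quadD N μ (opP K N W))
      (LieModule.toEnd K (Alg K N) W (H K N) - quadH N μ (opP K N W)) x := by
  refine LinearMap.congr_fun (f := (LieModule.toEnd K (Alg K N) W).toLinearMap) ?_ x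
  refine alg_hom_ext fun i => ?_
  rw [oscLin_gen]
  cases i
  · exact (sub_add_cancel _ _).symm
  · exact (sub_add_cancel _ _).symm
  · exact (sub_add_cancel _ _).symm
  · ext w
    exact hM w
  · change LieModule.toEnd K (Alg K N) W _ = _
    rw [P_val]
    rfl

end General

/-- The polynomial ring as a module over the algebra. -/
def FockMod (N : ℕ) {μ : K} (_ : μ ≠ 0) (_ : K) : Type _ := Fock K N

variable {μ : K} (hμ : μ ≠ 0) (lam : K)

noncomputable instance : AddCommGroup (FockMod N hμ lam) :=
  inferInstanceAs (AddCommGroup (Fock K N))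

noncomputable instance : Module K (FockMod N hμ lam) := inferInstanceAs (Module K (Fock K N))

theorem oscRep_lie_apply (x y : Alg K N) (f : Fock K N) :
    (fock_sl2 (N := N) μ lam).oscRep hμ ⁅x, y⁆ f =
      (fock_sl2 (N := N) μ lam).oscRep hμ x ((fock_sl2 (N := N) μ lam).oscRep hμ y f) -
      (fock_sl2 (N := N) μ lam).oscRep hμ y ((fock_sl2 (N := N) μ lam).oscRep hμ x f) := by
  rw [LieHom.map_lie]
  rfl

noncomputable instance : LieRingModule (Alg K N) (FockMod N hμ lam) where
  bracket x f := (fock_sl2 (N := N) μ lam).oscRep hμ x f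
  add_lie x y f := by
    change (fock_sl2 (N := N) μ lam).oscRep hμ (x + y) f = _
    rw [map_add]
    rfl
  lie_add x f g := map_add ((fock_sl2 (N := N) μ lam).oscRep hμ x) f g
  leibniz_lie x y f := by
    have h := oscRep_lie_apply hμ lam x y f
    exact sub_eq_iff_eq_add.mp h.symm

theorem fockMod_lie (x : Alg K N) (f : FockMod N hμ lam) :
    ⁅x, f⁆ = (oscLin N μ (fockP (N := N) μ) (mulX none) (fockD lam) (fockH lam) x f : Fock K N) :=
  rfl

noncomputable instance : LieModule K (Alg K N) (FockMod N hμ lam) where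
  smul_lie t x f := by
    change (fock_sl2 (N := N) μ lam).oscRep hμ (t • x) f = _
    rw [map_smul]
    rfl
  lie_smul t x f := map_smul ((fock_sl2 (N := N) μ lam).oscRep hμ x) t f

end Modules

/-! ### Operators preserving a subspace -/

section Stabilizer

variable {K : Type*} [Field K] {V : Type*} [AddCommGroup V] [Module K V]

/-- The subalgebra of endomorphisms preserving a subspace. -/
def stabilizer (S : Submodule K V) : Subalgebra K (Module.End K V) where
  carrier := {T | ∀ f ∈ S, T f ∈ S}
  mul_mem' hS hT f hf := hS _ (hT f hf)
  add_mem' hS hT f hf := S.add_mem (hS f hf) (hT f hf)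
  algebraMap_mem' a _ hf := S.smul_mem a hf

variable {A : Type*} [Ring A] [Algebra K A] {N : ℕ} {μ : K}

theorem quad_mem {p w : ℕ → A} {B : Subalgebra K A} (hp : ∀ n, p n ∈ B) (hw : ∀ n, w n ∈ B) :
    quad N μ p w ∈ B :=
  B.smul_mem (B.sum_mem fun n _ => B.smul_mem (B.mul_mem (hw n) (hp _)) _) _

theorem quadC_mem {p : ℕ → A} {B : Subalgebra K A} (hp : ∀ n, p n ∈ B) : quadC N μ p ∈ B :=
  quad_mem hp fun _ => B.smul_mem (hp _) _

theorem quadD_mem {p : ℕ → A} {B : Subalgebra K A} (hp : ∀ n, p n ∈ B) : quadD N μ p ∈ B :=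
  quad_mem hp fun _ => B.smul_mem (hp _) _

theorem quadH_mem {p : ℕ → A} {B : Subalgebra K A} (hp : ∀ n, p n ∈ B) : quadH N μ p ∈ B :=
  quad_mem hp fun _ => B.smul_mem (hp _) _

theorem oscLin_mem {p : ℕ → A} {c d h : A} {B : Subalgebra K A} (hp : ∀ n, p n ∈ B)
    (hc : c ∈ B) (hd : d ∈ B) (hh : h ∈ B) (x : Alg K N) : oscLin N μ p c d h x ∈ B := by
  have hx : x ∈ Submodule.span K (Set.range (genBasis K N)) := by
    rw [(genBasis K N).span_eq]
    trivial
  induction hx using Submodule.span_induction with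
  | mem x hx =>
    obtain ⟨i, rfl⟩ := hx
    change oscLin N μ p c d h (gen K i) ∈ B
    rw [oscLin_gen]
    cases i
    · exact B.add_mem hc (quadC_mem hp)
    · exact B.add_mem hd (quadD_mem hp)
    · exact B.add_mem hh (quadH_mem hp)
    · exact B.algebraMap_mem μ
    · exact hp _
  | zero => rw [map_zero]; exact B.zero_mem
  | add x y _ _ hx hy => rw [map_add]; exact B.add_mem hx hy
  | smul a x _ hx => rw [map_smul]; exact B.smul_mem hx a

end Stabilizer

/-! ### Coefficients, degree reduction and the ideal of `x^q` -/

section FockCoeff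

variable {K : Type*} [Field K] {N : ℕ}

open MvPolynomial

theorem coeff_diffX (i : Option (Fin (N + 1))) (f : Fock K N) (m : Option (Fin (N + 1)) →₀ ℕ) :
    coeff m (diffX i f) = coeff (m + Finsupp.single i 1) f * (m i + 1) := by
  rw [diffX_apply, coeff_pderiv]

theorem coeff_mulX_diffX (f : Fock K N) (m : Option (Fin (N + 1)) →₀ ℕ) :
    coeff m (mulX none (diffX none f)) = coeff m f * m none := by
  rw [mulX_apply, coeff_X_mul']
  split_ifs with h
  · have h1 : m none ≠ 0 := Finsupp.mem_support_iff.mp h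
    have h2 : m - Finsupp.single none 1 + Finsupp.single none 1 = m :=
      tsub_add_cancel_of_le (Finsupp.single_le_iff.mpr (by omega))
    rw [coeff_diffX, h2]
    congr 1
    rw [Finsupp.tsub_apply, Finsupp.single_eq_same]
    exact_mod_cast congrArg (Nat.cast (R := K)) (show m none - 1 + 1 = m none by omega)
  · rw [Finsupp.notMem_support_iff.mp h]
    simp

theorem coeff_fockD (lam : K) (f : Fock K N) (m : Option (Fin (N + 1)) →₀ ℕ) :
    coeff m (fockD lam f) = (lam - 2 * m none) * coeff m f := by
  unfold fockD
  rw [LinearMap.sub_apply, LinearMap.smul_apply, LinearMap.smul_apply, Module.End.mul_apply,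
    coeff_sub, coeff_smul, coeff_smul, coeff_mulX_diffX, Module.End.one_apply, smul_eq_mul,
    smul_eq_mul]
  ring

theorem coeff_fockH (lam : K) (f : Fock K N) (m : Option (Fin (N + 1)) →₀ ℕ) :
    coeff m (fockH lam f) =
      ((m none + 1) * (m none - lam)) * coeff (m + Finsupp.single none 1) f := by
  unfold fockH
  rw [LinearMap.sub_apply, LinearMap.smul_apply, Module.End.mul_apply, Module.End.mul_apply,
    coeff_sub, coeff_smul, coeff_mulX_diffX, coeff_diffX, smul_eq_mul]
  ring

/-- One works modulo polynomials all of whose monomials have exponent of `none` at least `T`: `T =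
⊤` treats the generic case, `T = q` the exceptional one. The derivatives and `fockH lam` lower the
degree. If all of them annihilate `f` modulo this ideal, then every nonconstant coefficient of `f`
below `T` is zero, since it occurs in one of the images with a nonzero factor; so `f` is a nonzero
constant modulo the ideal. -/
theorem one_mem_of_reduction [CharZero K] {lam : K} {T : ℕ∞}
    (hT : ∀ n : ℕ, ((n + 1 : ℕ) : ℕ∞) < T → (n : K) - lam ≠ 0) {S : Submodule K (Fock K N)}
    (hI : ∀ f : Fock K N, (∀ m, (m none : ℕ∞) < T → coeff m f = 0) → f ∈ S)
    (hdiff : ∀ i, ∀ f ∈ S, diffX (some i) f ∈ S) (hH : ∀ f ∈ S, fockH lam f ∈ S)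
    {f : Fock K N} (hf : f ∈ S) (hf0 : ¬ ∀ m, (m none : ℕ∞) < T → coeff m f = 0) :
    (1 : Fock K N) ∈ S := by
  have key : ∀ d : ℕ, ∀ f ∈ S, (¬ ∀ m, (m none : ℕ∞) < T → coeff m f = 0) →
      (∀ m, d ≤ Finsupp.degree m → coeff m f = 0) → (1 : Fock K N) ∈ S := by
    intro d
    induction d with
    | zero => exact fun f _ h1 h2 => absurd (fun m _ => h2 m (Nat.zero_le _)) h1
    | succ d ih =>
      intro f hf h1 h2
      have deg : ∀ (m : Option (Fin (N + 1)) →₀ ℕ) i,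
          Finsupp.degree (m + Finsupp.single i 1) = Finsupp.degree m + 1 := by
        intro m i
        rw [map_add, Finsupp.degree_single]
      -- Descent: as long as some lowering operator gives a nonzero result modulo the ideal, `f` is
      -- replaced by that result.
      by_cases hA : ∃ i, ¬ ∀ m, (m none : ℕ∞) < T → coeff m (diffX (some i) f) = 0
      · obtain ⟨i, hi⟩ := hA
        refine ih _ (hdiff i f hf) hi fun m hm => ?_
        rw [coeff_diffX, h2 _ (by rw [deg]; omega), zero_mul]
      by_cases hB : ¬ ∀ m, (m none : ℕ∞) < T → coeff m (fockH lam f) = 0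
      · refine ih _ (hH f hf) hB fun m hm => ?_
        rw [coeff_fockH, h2 _ (by rw [deg]; omega), mul_zero]
      push Not at hA hB
      have hz : ∀ m, (m none : ℕ∞) < T → m ≠ 0 → coeff m f = 0 := by
        intro m hm hm0
        obtain ⟨i, hi⟩ : ∃ i, m i ≠ 0 := by
          by_contra! h
          exact hm0 (Finsupp.ext h)
        have e : m - Finsupp.single i 1 + Finsupp.single i 1 = m :=
          tsub_add_cancel_of_le (Finsupp.single_le_iff.mpr (by omega))
        rcases i with _ | i
        · have e1 : (m - Finsupp.single none 1 : Option (Fin (N + 1)) →₀ ℕ) none + 1 = m none := by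
            rw [Finsupp.tsub_apply, Finsupp.single_eq_same]
            omega
          have h := hB (m - Finsupp.single none 1) (lt_of_le_of_lt (by
            exact_mod_cast (by omega)) hm)
          rw [coeff_fockH, e] at h
          refine (mul_eq_zero.mp h).resolve_left
            (mul_ne_zero (Nat.cast_add_one_ne_zero _) (hT _ ?_))
          · rwa [e1]
        · have h := hA i (m - Finsupp.single (some i) 1) (lt_of_le_of_lt (by
            rw [Finsupp.tsub_apply]
            exact_mod_cast Nat.sub_le _ _) hm)
          rw [coeff_diffX, e] at h
          exact (mul_eq_zero.mp h).resolve_right (Nat.cast_add_one_ne_zero _)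
      have h0 : coeff 0 f ≠ 0 := by
        intro h0
        refine h1 fun m hm => ?_
        by_cases hm0 : m = 0
        · rw [hm0, h0]
        · exact hz m hm hm0
      have h3 : f - MvPolynomial.C (coeff 0 f) ∈ S := by
        refine hI _ fun m hm => ?_
        rw [coeff_sub, coeff_C]
        split_ifs with hm0
        · rw [← hm0, sub_self]
        · rw [hz m hm (Ne.symm hm0), sub_zero]
      have h4 := S.smul_mem (coeff 0 f)⁻¹ (S.sub_mem hf h3)
      rwa [sub_sub_cancel, C_eq_smul_one, smul_smul, inv_mul_cancel₀ h0, one_smul] at h4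
  refine key (f.totalDegree + 1) f hf hf0 fun m hm => ?_
  refine coeff_eq_zero_of_totalDegree_lt ?_
  rw [Finsupp.degree_apply] at hm
  exact hm

theorem mul_mem_of_mulX {S : Submodule K (Fock K N)} (hX : ∀ i, ∀ f ∈ S, mulX i f ∈ S)
    {f : Fock K N} (hf : f ∈ S) (g : Fock K N) : g * f ∈ S := by
  induction g using MvPolynomial.induction_on with
  | C a =>
    rw [C_mul']
    exact S.smul_mem a hf
  | add g h hg hh =>
    rw [add_mul]
    exact S.add_mem hg hh
  | mul_X g i hg =>
    rw [mul_comm g, mul_assoc]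
    exact hX i _ hg

theorem mem_of_X_pow_mem {S : Submodule K (Fock K N)} (hX : ∀ i, ∀ f ∈ S, mulX i f ∈ S) {q : ℕ}
    (hq : (X none : Fock K N) ^ q ∈ S) {f : Fock K N} (hf : ∀ m, m none < q → coeff m f = 0) :
    f ∈ S := by
  rw [f.as_sum]
  refine S.sum_mem fun m hm => ?_
  have h1 : q ≤ m none := by
    by_contra! h
    exact (mem_support_iff.mp hm) (hf m h)
  have e : m - Finsupp.single none q + Finsupp.single none q = m :=
    tsub_add_cancel_of_le (Finsupp.single_le_iff.mpr h1)
  have h2 : monomial m (coeff m f) =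
      monomial (m - Finsupp.single none q) (coeff m f) * X none ^ q := by
    rw [X_pow_eq_monomial, monomial_mul, e, mul_one]
  rw [h2]
  exact mul_mem_of_mulX hX hq _

/-- The subspace of polynomials divisible by the `q`-th power of the variable `none`. -/
def fockIdeal (K : Type*) [Field K] (N q : ℕ) : Submodule K (Fock K N) where
  carrier := {f | ∀ m : Option (Fin (N + 1)) →₀ ℕ, m none < q → coeff m f = 0}
  zero_mem' m _ := coeff_zero m
  add_mem' hf hg m hm := by rw [coeff_add, hf m hm, hg m hm, add_zero]
  smul_mem' a f hf m hm := by rw [coeff_smul, hf m hm, smul_zero]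

theorem X_pow_mem_fockIdeal (q : ℕ) : (X none : Fock K N) ^ q ∈ fockIdeal K N q := by
  intro m hm
  rw [coeff_X_pow, if_neg]
  rintro rfl
  simp at hm

theorem one_notMem_fockIdeal {q : ℕ} (hq : 1 ≤ q) : (1 : Fock K N) ∉ fockIdeal K N q := by
  intro h
  have := h 0 (by rw [Finsupp.zero_apply]; omega)
  simp at this

theorem mulX_mem_fockIdeal {q : ℕ} (i : Option (Fin (N + 1))) :
    mulX i ∈ stabilizer (fockIdeal K N q) := by
  intro f hf m hm
  rw [mulX_apply, coeff_X_mul']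
  split_ifs
  · exact hf _ (lt_of_le_of_lt (by rw [Finsupp.tsub_apply]; exact Nat.sub_le _ _) hm)
  · rfl

theorem diffX_mem_fockIdeal {q : ℕ} (i : Fin (N + 1)) :
    diffX (some i) ∈ stabilizer (fockIdeal K N q) := by
  intro f hf m hm
  rw [coeff_diffX, hf _ (by simpa using hm), zero_mul]

theorem fockP_mem_fockIdeal {q : ℕ} (μ : K) (n : ℕ) :
    fockP μ n ∈ stabilizer (fockIdeal K N q) := by
  unfold fockP
  split_ifs
  · exact Subalgebra.smul_mem _ (diffX_mem_fockIdeal _) _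
  · exact mulX_mem_fockIdeal _
  · exact Subalgebra.zero_mem _

/-- Only `fockH` lowers the exponent of `none`, and its passage from exponent `q` to `q - 1` carries
the factor `q - 1 - lam = 0`. -/
theorem oscLin_mem_fockIdeal {q : ℕ} {lam : K} (hlam : lam = q - 1) (μ : K) (x : Alg K N) :
    oscLin N μ (fockP μ) (mulX none) (fockD lam) (fockH lam) x ∈
      stabilizer (fockIdeal K N q) := by
  refine oscLin_mem (fockP_mem_fockIdeal μ) (mulX_mem_fockIdeal none) ?_ ?_ x
  · intro f hf m hm
    rw [coeff_fockD, hf m hm, mul_zero]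
  · intro f hf m hm
    rw [coeff_fockH]
    rcases Nat.lt_or_ge (m none + 1) q with h | h
    · rw [hf _ (by simpa using h), mul_zero]
    · have : q = m none + 1 := by omega
      rw [hlam, this]
      push_cast
      ring

end FockCoeff

/-! ### Submodules and powers of `none` in the polynomial module -/

section FockMod

variable {K : Type*} [Field K] [CharZero K] {N : ℕ} {μ : K} (hμ : μ ≠ 0) (lam : K)

open MvPolynomial

theorem fockMod_P (n : ℕ) (f : FockMod N hμ lam) :
    ⁅P K N n, f⁆ = (fockP μ n f : Fock K N) := by
  rw [fockMod_lie, oscLin_P (fockP_heisenberg μ)]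

variable {hμ lam}
variable (S : LieSubmodule K (Alg K N) (FockMod N hμ lam))

/-- A Lie submodule of the polynomial module, as a subspace of the polynomial ring. -/
def fockSubmodule : Submodule K (Fock K N) := S.toSubmodule

theorem oscLin_mem_stabilizer (x : Alg K N) :
    oscLin N μ (fockP (N := N) μ) (mulX none) (fockD lam) (fockH lam) x ∈
      stabilizer (fockSubmodule S) :=
  fun _ hf => S.lie_mem (x := x) hf

theorem fockP_mem_stabilizer (n : ℕ) : fockP μ n ∈ stabilizer (fockSubmodule S) := by
  intro f hf
  have h := oscLin_mem_stabilizer S (P K N n) f hf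
  rwa [oscLin_P (fockP_heisenberg μ)] at h

theorem mulX_mem_stabilizer (i : Option (Fin (N + 1))) :
    mulX i ∈ stabilizer (fockSubmodule S) := by
  rcases i with _ | i
  · have h := oscLin_mem_stabilizer S (C K N)
    rw [oscLin_C] at h
    simpa using Subalgebra.sub_mem _ h (quadC_mem (N := N) (μ := μ) (fockP_mem_stabilizer S))
  · rw [mulX_some μ]
    exact fockP_mem_stabilizer S _

theorem fockH_mem_stabilizer : fockH lam ∈ stabilizer (fockSubmodule S) := by
  have h := oscLin_mem_stabilizer S (H K N)
  rw [oscLin_H] at h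
  simpa using Subalgebra.sub_mem _ h (quadH_mem (N := N) (μ := μ) (fockP_mem_stabilizer S))

theorem diffX_mem_stabilizer (i : Fin (N + 1)) : diffX (some i) ∈ stabilizer (fockSubmodule S) := by
  -- `P_{N-i}` acts as a nonzero multiple of the derivative with index `i`.
  have h := fockP_mem_stabilizer S (N - i)
  rw [fockP_of_le μ (by omega)] at h
  have e : Fin.ofNat (N + 1) (N - (N - i)) = i := by
    ext
    simp only [Fin.ofNat]
    rw [Nat.mod_eq_of_lt (by omega)]
    omega
  rw [e] at h
  have h2 := Subalgebra.smul_mem _ h (strI K N (N - i) * μ)⁻¹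
  rwa [smul_smul, inv_mul_cancel₀ (mul_ne_zero (strI_ne_zero _ _) hμ), one_smul] at h2

theorem eq_top_of_one_mem (h : (1 : Fock K N) ∈ fockSubmodule S) : S = ⊤ := by
  refine eq_top_iff.mpr fun f _ => ?_
  have h1 := mul_mem_of_mulX (fun i => mulX_mem_stabilizer S i) h (f : Fock K N)
  exact mul_one (M := Fock K N) f ▸ h1

theorem eq_top_of_ne_zero (hlam : ∀ n : ℕ, lam ≠ n) {f : FockMod N hμ lam} (hf : f ∈ S)
    (hf0 : f ≠ 0) : S = ⊤ := by
  refine eq_top_of_one_mem S (one_mem_of_reduction (T := ⊤) (lam := lam) (f := f) ?_ ?_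
    (fun i => diffX_mem_stabilizer S i) (fockH_mem_stabilizer S) hf ?_)
  · exact fun n _ => sub_ne_zero.mpr (hlam n).symm
  · intro f hf
    have : f = 0 := by
      ext m
      exact hf m (ENat.natCast_lt_top _)
    rw [this]
    exact Submodule.zero_mem _
  · intro h
    refine hf0 (MvPolynomial.ext (σ := Option (Fin (N + 1))) (R := K) _ _ fun m => ?_)
    exact h m (ENat.natCast_lt_top _)

theorem fockIdeal_le {q : ℕ} (hS : (X none : Fock K N) ^ q ∈ fockSubmodule S) :
    fockIdeal K N q ≤ fockSubmodule S :=
  fun _ hf => mem_of_X_pow_mem (fun i => mulX_mem_stabilizer S i) hS hf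

/-- Below exponent `q` the factors `n - lam` vanish only at `n = q - 1`, and the reduction uses only
`n + 1 < q`. -/
theorem eq_top_of_notMem_fockIdeal {q : ℕ} (hlam : lam = q - 1)
    (hS : (X none : Fock K N) ^ q ∈ fockSubmodule S) {f : Fock K N} (hf : f ∈ fockSubmodule S)
    (hf0 : f ∉ fockIdeal K N q) : S = ⊤ := by
  refine eq_top_of_one_mem S (one_mem_of_reduction (T := q) (lam := lam) (f := f) ?_ ?_
    (fun i => diffX_mem_stabilizer S i) (fockH_mem_stabilizer S) hf ?_)
  · intro n hn h
    have hn : n + 1 < q := by exact_mod_cast hn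
    rw [hlam] at h
    have : ((n + 1 : ℕ) : K) = q := by
      push_cast
      linear_combination h
    have := Nat.cast_injective this
    omega
  · intro f hf
    exact fockIdeal_le S hS fun m hm => hf m (by exact_mod_cast hm)
  · intro h
    exact hf0 fun m hm => h m (by exact_mod_cast hm)

variable (hμ lam)

/-- The polynomials divisible by the `q`-th power of the variable `none` form a submodule. -/
def fockIdealLie {q : ℕ} (hlam : lam = q - 1) : LieSubmodule K (Alg K N) (FockMod N hμ lam) where
  toSubmodule := fockIdeal K N q
  lie_mem {x f} hf := oscLin_mem_fockIdeal hlam μ x f hf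

omit [CharZero K] in
theorem fockP_X_pow {n : ℕ} (hn : n ≤ N) (k : ℕ) :
    fockP (N := N) μ n ((X none : Fock K N) ^ k) = 0 := by
  rw [fockP_of_le μ hn, LinearMap.smul_apply, diffX_apply, pderiv_pow, pderiv_X_of_ne (by simp),
    mul_zero, smul_zero]

omit [CharZero K] in
theorem fockD_X_pow (k : ℕ) : fockD lam ((X none : Fock K N) ^ k) = (lam - 2 * k) • X none ^ k := by
  ext m
  rw [coeff_fockD, coeff_smul, coeff_X_pow]
  split_ifs with h
  · rw [← h]
    simp
  · simp

omit [CharZero K] in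
theorem fockH_X_pow {q : ℕ} (hlam : lam = q - 1) :
    fockH lam ((X none : Fock K N) ^ q) = 0 := by
  ext m
  rw [coeff_fockH, coeff_X_pow, coeff_zero]
  split_ifs with h
  · have h1 : q = m none + 1 := by
      have := DFunLike.congr_fun h none
      simpa using this
    rw [hlam, h1]
    push_cast
    ring
  · rw [mul_zero]

omit [CharZero K] in
theorem fockH_one : fockH lam (1 : Fock K N) = 0 := by
  ext m
  rw [coeff_fockH, coeff_one, coeff_zero, if_neg, mul_zero]
  intro h
  have := DFunLike.congr_fun h none
  simp at this

theorem fockMod_M (f : FockMod N hμ lam) : ⁅M K N, f⁆ = μ • f := by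
  rw [fockMod_lie, oscLin_M]
  rfl

/-- The powers of the variable `none`. -/
noncomputable def fockPow (k : ℕ) : FockMod N hμ lam := ((X none : Fock K N) ^ k : Fock K N)

theorem fockMod_P_pow {n : ℕ} (hn : n ≤ N) (k : ℕ) : ⁅P K N n, fockPow (N := N) hμ lam k⁆ = 0 := by
  rw [fockMod_P]
  exact fockP_X_pow hn k

theorem fockMod_D_pow (k : ℕ) :
    ⁅D K N, fockPow (N := N) hμ lam k⁆ =
      (lam - 1 / 2 * ((N : K) + 1) ^ 2 - 2 * k) • fockPow hμ lam k := by
  have h := quadD_vacuum (fockP_heisenberg μ) (fun n hn => fockP_X_pow (N := N) hn k) hμ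
  change oscLin N μ (fockP μ) (mulX none) (fockD lam) (fockH lam) (D K N) (X none ^ k) =
    ((lam - 1 / 2 * ((N : K) + 1) ^ 2 - 2 * k) • X none ^ k : Fock K N)
  rw [oscLin_D, LinearMap.add_apply, fockD_X_pow, h, ← add_smul]
  congr 1
  ring

theorem fockMod_H_pow {k : ℕ} (hk : fockH lam ((X none : Fock K N) ^ k) = 0) :
    ⁅H K N, fockPow (N := N) hμ lam k⁆ = 0 := by
  have h := quadH_vacuum (fockP_heisenberg μ) (fun n hn => fockP_X_pow (N := N) hn k)
  change oscLin N μ (fockP μ) (mulX none) (fockD lam) (fockH lam) (H K N) (X none ^ k) =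
    (0 : Fock K N)
  rw [oscLin_H, LinearMap.add_apply, h, hk, add_zero]

/-- Powers of `none` are vacuum vectors, so `P_{N+1}²` cancels the `quadC` part of `α_ℓ μ C` and
only multiplication by `none` remains. This is how the singular vector becomes a pure power. -/
theorem fockMod_C_pow (k : ℕ) :
    (2 * (N.factorial : K) ^ 2 * μ) • ⁅C K N, fockPow (N := N) hμ lam k⁆ -
      ⁅P K N (N + 1), ⁅P K N (N + 1), fockPow (N := N) hμ lam k⁆⁆ =
      (2 * (N.factorial : K) ^ 2 * μ) • fockPow hμ lam (k + 1) := by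
  have h1 : (N.factorial : K) ≠ 0 := by exact_mod_cast N.factorial_ne_zero
  have h2 : 2 * (N.factorial : K) ^ 2 * μ ≠ 0 := by simp [h1, hμ]
  have h := quadC_vacuum (fockP_heisenberg μ) (fun n hn => fockP_X_pow (N := N) hn k) hμ
  have key : (2 * (N.factorial : K) ^ 2 * μ) •
      oscLin N μ (fockP μ) (mulX none) (fockD lam) (fockH lam) (C K N) ((X none : Fock K N) ^ k) -
      fockP μ (N + 1) (fockP μ (N + 1) ((X none : Fock K N) ^ k)) =
      (2 * (N.factorial : K) ^ 2 * μ) • (X none : Fock K N) ^ (k + 1) := by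
    rw [oscLin_C, LinearMap.add_apply, mulX_apply, h, ← pow_succ', smul_add, smul_smul,
      mul_inv_cancel₀ h2, one_smul, add_sub_cancel_right]
  rw [fockMod_P, fockMod_P]
  exact key

end FockMod

/-! ### Highest weight modules: generation, weights, dimension -/

section HighestWeight

variable {K : Type*} [Field K] [CharZero K] {N : ℕ}

/-- By the universal property the canonical map lifts to `U → B`. Followed by the inclusion it is
the identity, so `B` is everything. -/
theorem mem_of_toU_mem {B : Subalgebra K (U K N)} (h : ∀ x, toU K N x ∈ B) (u : U K N) :
    u ∈ B := by
  let j : Alg K N →ₗ⁅K⁆ B :=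
    { toFun := fun x => ⟨toU K N x, h x⟩
      map_add' := fun x y => Subtype.ext (map_add (toU K N) x y)
      map_smul' := fun a x => Subtype.ext (map_smul (toU K N) a x)
      map_lie' := fun {x y} => Subtype.ext (LieHom.map_lie (toU K N) x y) }
  have e : B.val.comp (UniversalEnvelopingAlgebra.lift K j) = AlgHom.id K (U K N) := by
    refine UniversalEnvelopingAlgebra.hom_ext K (LieHom.ext fun x => ?_)
    change B.val (UniversalEnvelopingAlgebra.lift K j (UniversalEnvelopingAlgebra.ι K x)) = _
    rw [UniversalEnvelopingAlgebra.lift_ι_apply]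
    rfl
  have := AlgHom.congr_fun e u
  rw [AlgHom.id_apply] at this
  rw [← this]
  exact Subtype.property _

variable {W : Type*} [AddCommGroup W] [Module K W] [LieRingModule (Alg K N) W]
  [LieModule K (Alg K N) W]

variable (K N W) in
/-- The action of the universal enveloping algebra on a module. -/
noncomputable def envRep : U K N →ₐ[K] Module.End K W :=
  UniversalEnvelopingAlgebra.lift K (LieModule.toEnd K (Alg K N) W)

theorem envRep_toU (x : Alg K N) (w : W) : envRep K N W (toU K N x) w = ⁅x, w⁆ := by
  unfold envRep
  rw [UniversalEnvelopingAlgebra.lift_ι_apply]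
  rfl

theorem envRep_mem (S : LieSubmodule K (Alg K N) W) (u : U K N) {w : W} (hw : w ∈ S) :
    envRep K N W u w ∈ S := by
  have h : ∀ x, toU K N x ∈ (stabilizer S.toSubmodule).comap (envRep K N W) := by
    intro x w hw
    change envRep K N W (toU K N x) w ∈ S
    rw [envRep_toU]
    exact S.lie_mem hw
  exact mem_of_toU_mem h u w hw

theorem lie_M_eq {μ : K} {v : W} (hv : ⁅M K N, v⁆ = μ • v)
    (hgen : LieSubmodule.lieSpan K (Alg K N) {v} = ⊤) (w : W) : ⁅M K N, w⁆ = μ • w := by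
  let S : LieSubmodule K (Alg K N) W :=
    { carrier := {w | ⁅M K N, w⁆ = μ • w}
      zero_mem' := by simp
      add_mem' := fun {a b} ha hb => by
        change ⁅M K N, a + b⁆ = μ • (a + b)
        rw [lie_add, smul_add, ha, hb]
      smul_mem' := fun c a ha => by
        change ⁅M K N, c • a⁆ = μ • c • a
        rw [lie_smul, ha, smul_comm]
      lie_mem := fun {x a} ha => by
        change ⁅M K N, ⁅x, a⁆⁆ = μ • ⁅x, a⁆
        rw [leibniz_lie, lie_def, brL_M_left, zero_lie, zero_add, ← lie_smul]
        exact congrArg _ ha }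
  have h : LieSubmodule.lieSpan K (Alg K N) {v} ≤ S :=
    LieSubmodule.lieSpan_le.mpr (Set.singleton_subset_iff.mpr hv)
  rw [hgen] at h
  exact h (LieSubmodule.mem_top w)

/-- `v` satisfies the equations of a highest weight vector of weight `(δ, μ)`. -/
structure IsHighestWeightVector (N : ℕ) (δ μ : K) {W : Type*} [AddCommGroup W] [Module K W]
    [LieRingModule (Alg K N) W] (v : W) : Prop where
  lie_D : ⁅D K N, v⁆ = δ • v
  lie_M : ⁅M K N, v⁆ = μ • v
  lie_gPlus : ∀ x ∈ gPlus K N, ⁅x, v⁆ = 0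

namespace IsHighestWeightVector

variable {V : Type*} [AddCommGroup V] [Module K V] [LieRingModule (Alg K N) V]
  [LieModule K (Alg K N) V] {δ μ : K}

omit [LieModule K (Alg K N) W] [LieModule K (Alg K N) V] in
theorem map {v : V} (hv : IsHighestWeightVector N δ μ v) (f : V →ₗ⁅K,Alg K N⁆ W) :
    IsHighestWeightVector N δ μ (f v) where
  lie_D := by rw [← LieModuleHom.map_lie, hv.lie_D, map_smul]
  lie_M := by rw [← LieModuleHom.map_lie, hv.lie_M, map_smul]
  lie_gPlus x hx := by rw [← LieModuleHom.map_lie, hv.lie_gPlus x hx, map_zero]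

omit [LieModule K (Alg K N) V] in
theorem lie_H {v : V} (hv : IsHighestWeightVector N δ μ v) : ⁅H K N, v⁆ = 0 :=
  hv.lie_gPlus _ (Or.inl rfl)

omit [LieModule K (Alg K N) V] in
theorem lie_P {v : V} (hv : IsHighestWeightVector N δ μ v) {n : ℕ} (hn : n ≤ N) :
    ⁅P K N n, v⁆ = 0 :=
  hv.lie_gPlus _ (Or.inr ⟨n, hn, rfl⟩)

theorem smul {v : V} (hv : IsHighestWeightVector N δ μ v) (a : K) :
    IsHighestWeightVector N δ μ (a • v) where
  lie_D := by rw [lie_smul, hv.lie_D, smul_comm]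
  lie_M := by rw [lie_smul, hv.lie_M, smul_comm]
  lie_gPlus x hx := by rw [lie_smul, hv.lie_gPlus x hx, smul_zero]

end IsHighestWeightVector

variable (K N) in
/-- The subspace `U(g⁻) v`. -/
noncomputable def uMinusSubmodule (v : W) : Submodule K W :=
  (Subalgebra.toSubmodule (UMinus K N)).map
    ((LinearMap.applyₗ v).comp (envRep K N W).toLinearMap)

theorem mem_uMinusSubmodule {v w : W} :
    w ∈ uMinusSubmodule K N v ↔ ∃ u ∈ UMinus K N, envRep K N W u v = w := Iff.rfl

theorem self_mem_uMinusSubmodule (v : W) : v ∈ uMinusSubmodule K N v :=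
  ⟨1, Subalgebra.one_mem _, by simp⟩

theorem lie_mem_uMinusSubmodule {v w : W} {x : Alg K N} (hx : x ∈ gMinus K N)
    (hw : w ∈ uMinusSubmodule K N v) : ⁅x, w⁆ ∈ uMinusSubmodule K N v := by
  obtain ⟨u, hu, rfl⟩ := mem_uMinusSubmodule.mp hw
  refine mem_uMinusSubmodule.mpr ⟨toU K N x * u, Subalgebra.mul_mem _
    (Algebra.subset_adjoin ⟨x, hx, rfl⟩) hu, ?_⟩
  rw [map_mul, Module.End.mul_apply, envRep_toU]

theorem uMinusSubmodule_le {v : W} {T : Submodule K W} (hv : v ∈ T)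
    (hT : ∀ x ∈ gMinus K N, ∀ w ∈ T, ⁅x, w⁆ ∈ T) : uMinusSubmodule K N v ≤ T := by
  intro w hw
  obtain ⟨u, hu, rfl⟩ := mem_uMinusSubmodule.mp hw
  have h : UMinus K N ≤ (stabilizer T).comap (envRep K N W) := by
    refine Algebra.adjoin_le ?_
    rintro _ ⟨x, hx, rfl⟩ w hw
    change envRep K N W (toU K N x) w ∈ T
    rw [envRep_toU]
    exact hT x hx w hw
  exact h hu v hv

omit [CharZero K] in
theorem induction_gen {T : Submodule K (Alg K N)} (h : ∀ i, gen K i ∈ T) (x : Alg K N) : x ∈ T := by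
  have h1 : Submodule.span K (Set.range (genBasis K N)) ≤ T :=
    Submodule.span_le.mpr (by
      rintro _ ⟨i, rfl⟩
      exact h i)
  rw [(genBasis K N).span_eq] at h1
  exact h1 trivial

theorem lie_mem_uMinusSubmodule_self {δ μ : K} {v : W} (hv : IsHighestWeightVector N δ μ v)
    (x : Alg K N) : ⁅x, v⁆ ∈ uMinusSubmodule K N v := by
  refine induction_gen (T := (uMinusSubmodule K N v).comap
    ((LieModule.toEnd K (Alg K N) W).toLinearMap.flip v)) (fun i => ?_) x
  change ⁅gen K i, v⁆ ∈ uMinusSubmodule K N v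
  have h0 := self_mem_uMinusSubmodule (K := K) (N := N) v
  cases i with
  | C => exact lie_mem_uMinusSubmodule (Or.inl rfl) h0
  | D =>
    change ⁅D K N, v⁆ ∈ _
    rw [hv.lie_D]
    exact Submodule.smul_mem _ _ h0
  | H =>
    change ⁅H K N, v⁆ ∈ _
    rw [hv.lie_H]
    exact Submodule.zero_mem _
  | M =>
    change ⁅M K N, v⁆ ∈ _
    rw [hv.lie_M]
    exact Submodule.smul_mem _ _ h0
  | P n =>
    rw [P_val]
    rcases Nat.lt_or_ge N n with h | h
    · exact lie_mem_uMinusSubmodule (Or.inr ⟨n, h, by omega, rfl⟩) h0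
    · rw [hv.lie_P h]
      exact Submodule.zero_mem _

/-- Replaces the triangular decomposition of `U(g)`. For `y ∈ g⁻` one has `z y w = [z, y] w + y z
w`; quantifying over all `z` in the definition of `T` handles `[z, y]`, so `T` is stable under `g⁻`.
-/
theorem lie_mem_uMinusSubmodule_of_hwv {δ μ : K} {v : W} (hv : IsHighestWeightVector N δ μ v)
    (x : Alg K N) {w : W} (hw : w ∈ uMinusSubmodule K N v) : ⁅x, w⁆ ∈ uMinusSubmodule K N v := by
  let T : Submodule K W :=
    { carrier := {w | w ∈ uMinusSubmodule K N v ∧ ∀ z : Alg K N, ⁅z, w⁆ ∈ uMinusSubmodule K N v}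
      zero_mem' := ⟨Submodule.zero_mem _, fun z => by
        rw [lie_zero]
        exact Submodule.zero_mem _⟩
      add_mem' := fun ha hb => ⟨Submodule.add_mem _ ha.1 hb.1, fun z => by
        rw [lie_add]
        exact Submodule.add_mem _ (ha.2 z) (hb.2 z)⟩
      smul_mem' := fun c _ ha => ⟨Submodule.smul_mem _ c ha.1, fun z => by
        rw [lie_smul]
        exact Submodule.smul_mem _ c (ha.2 z)⟩ }
  have h : uMinusSubmodule K N v ≤ T := by
    refine uMinusSubmodule_le ⟨self_mem_uMinusSubmodule v, lie_mem_uMinusSubmodule_self hv⟩ ?_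
    intro y hy w hw
    refine ⟨lie_mem_uMinusSubmodule hy hw.1, fun z => ?_⟩
    rw [leibniz_lie]
    exact Submodule.add_mem _ (hw.2 _) (lie_mem_uMinusSubmodule hy (hw.2 z))
  exact (h hw).2 x

theorem lieSpan_eq_uMinusSubmodule {δ μ : K} {v : W} (hv : IsHighestWeightVector N δ μ v) :
    (LieSubmodule.lieSpan K (Alg K N) {v}).toSubmodule = uMinusSubmodule K N v := by
  apply le_antisymm
  · let S : LieSubmodule K (Alg K N) W :=
      { toSubmodule := uMinusSubmodule K N v
        lie_mem := fun {x _} hw => lie_mem_uMinusSubmodule_of_hwv hv x hw }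
    have h : LieSubmodule.lieSpan K (Alg K N) {v} ≤ S :=
      LieSubmodule.lieSpan_le.mpr (Set.singleton_subset_iff.mpr (self_mem_uMinusSubmodule v))
    exact h
  · exact uMinusSubmodule_le (LieSubmodule.subset_lieSpan rfl)
      fun x _ w hw => LieSubmodule.lie_mem _ hw

omit [CharZero K] in
theorem lie_D_gMinus {x : Alg K N} (hx : x ∈ gMinus K N) :
    ∃ j : ℕ, brL K N (D K N) x = (-(j : K)) • x := by
  rcases hx with rfl | ⟨n, h1, h2, rfl⟩
  · exact ⟨2, by rw [brL_D_C]; norm_num⟩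
  · refine ⟨2 * (n - (N + 1)) + 1, ?_⟩
    rw [brL_D_P]
    congr 1
    obtain ⟨k, rfl⟩ := Nat.exists_eq_add_of_le h1
    rw [Nat.add_sub_cancel_left]
    push_cast
    ring

theorem uMinusSubmodule_le_eigenspaces {lam : K} {v : W} (hv : ⁅D K N, v⁆ = lam • v) :
    uMinusSubmodule K N v ≤
      ⨆ j : ℕ, Module.End.eigenspace (LieModule.toEnd K (Alg K N) W (D K N)) (lam - j) := by
  refine uMinusSubmodule_le ?_ fun x hx w hw => ?_
  · refine Submodule.mem_iSup_of_mem 0 (Module.End.mem_eigenspace_iff.mpr ?_)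
    rw [Nat.cast_zero, sub_zero]
    exact hv
  · obtain ⟨k, hk⟩ := lie_D_gMinus hx
    induction hw using Submodule.iSup_induction' with
    | mem j w hw =>
      refine Submodule.mem_iSup_of_mem (j + k) (Module.End.mem_eigenspace_iff.mpr ?_)
      have h1 : ⁅D K N, w⁆ = (lam - (j : K)) • w := Module.End.mem_eigenspace_iff.mp hw
      change ⁅D K N, ⁅x, w⁆⁆ = _
      rw [leibniz_lie, lie_def, hk, h1, smul_lie, lie_smul]
      push_cast
      module
    | zero => rw [lie_zero]; exact Submodule.zero_mem _
    | add a b _ _ ha hb => rw [lie_add]; exact Submodule.add_mem _ ha hb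

/-- Elements of `g⁻` lower the `D`-weight by natural numbers, so the module is a sum of eigenspaces
with eigenvalues in `δ - ℕ`. Independence of eigenspaces excludes any other eigenvalue. -/
theorem weight_eq_sub {δ μ κ : K} {v w : W} (hv : IsHighestWeightVector N δ μ v)
    (hgen : LieSubmodule.lieSpan K (Alg K N) {v} = ⊤) (hw0 : w ≠ 0) (hw : ⁅D K N, w⁆ = κ • w) :
    ∃ j : ℕ, κ = δ - j := by
  by_contra! h
  have h1 : w ∈ uMinusSubmodule K N v := by
    rw [← lieSpan_eq_uMinusSubmodule hv, hgen]
    trivial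
  have h2 := uMinusSubmodule_le_eigenspaces hv.lie_D h1
  have h3 := (Module.End.eigenspaces_iSupIndep (LieModule.toEnd K (Alg K N) W (D K N))) κ
  refine hw0 (Submodule.disjoint_def.mp h3 w (Module.End.mem_eigenspace_iff.mpr hw) ?_)
  refine (iSup_le fun j => ?_ : (⨆ j : ℕ, Module.End.eigenspace
    (LieModule.toEnd K (Alg K N) W (D K N)) (δ - j)) ≤ _) h2
  exact le_iSup₂_of_le (δ - (j : K)) (h j).symm le_rfl

/-- `[P_N, P_{N+1}]` is a nonzero scalar; in finite dimension its trace is zero, forcing dimension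
`0` in characteristic zero. -/
theorem not_finiteDimensional_of_hwm {δ μ : K} (hμ : μ ≠ 0) (h : IsHighestWeightModule N δ μ W) :
    ¬ FiniteDimensional K W := by
  intro hfin
  obtain ⟨v, hv0, -, hM, -, hgen⟩ := h
  have hp := (opP_heisenberg (lie_M_eq hM hgen)).comm N (N + 1)
  have h1 := congrArg (LinearMap.trace K W) hp
  rw [map_sub, LinearMap.trace_mul_comm, sub_self, if_pos (by omega), map_smul,
    LinearMap.trace_one, smul_eq_mul] at h1
  have h2 := (mul_eq_zero.mp h1.symm).resolve_left (mul_ne_zero (strI_ne_zero _ _) hμ)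
  have h3 : Module.finrank K W = 0 := by exact_mod_cast h2
  have := Module.finrank_zero_iff.mp h3
  exact hv0 (Subsingleton.elim _ _)

/-- Each highest weight lies below the other by a natural number, so they agree; `M` acts on the
whole module by one scalar. -/
theorem weights_unique {δ μ δ' μ' : K} (h : IsHighestWeightModule N δ μ W)
    (h' : IsHighestWeightModule N δ' μ' W) : δ' = δ ∧ μ' = μ := by
  obtain ⟨v, hv0, hD, hM, hP, hgen⟩ := h
  obtain ⟨v', hv0', hD', hM', hP', hgen'⟩ := h'
  constructor
  · obtain ⟨j, hj⟩ := weight_eq_sub ⟨hD, hM, hP⟩ hgen hv0' hD'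
    obtain ⟨k, hk⟩ := weight_eq_sub ⟨hD', hM', hP'⟩ hgen' hv0 hD
    have h1 : ((j + k : ℕ) : K) = 0 := by
      push_cast
      linear_combination hj + hk
    have h2 : j + k = 0 := by exact_mod_cast h1
    have h3 : j = 0 := by omega
    rw [hj, h3, Nat.cast_zero, sub_zero]
  · have h1 := lie_M_eq hM hgen v'
    rw [hM'] at h1
    exact smul_left_injective K hv0' h1

variable {V : Type*} [AddCommGroup V] [Module K V] [LieRingModule (Alg K N) V]
  [LieModule K (Alg K N) V]

omit [LieModule K (Alg K N) V] [LieModule K (Alg K N) W] in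
theorem surjective_of_generator (f : V →ₗ⁅K,Alg K N⁆ W) {v : V}
    (hgen : LieSubmodule.lieSpan K (Alg K N) {f v} = ⊤) : Function.Surjective f := by
  have h : LieSubmodule.lieSpan K (Alg K N) {f v} ≤ f.range :=
    LieSubmodule.lieSpan_le.mpr (Set.singleton_subset_iff.mpr ⟨v, rfl⟩)
  rw [hgen] at h
  intro w
  exact h (LieSubmodule.mem_top w)

omit [LieModule K (Alg K N) V] [LieModule K (Alg K N) W] in
theorem lieSpan_map_eq_top {f : V →ₗ⁅K,Alg K N⁆ W} (hf : Function.Surjective f) {v : V}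
    (hgen : LieSubmodule.lieSpan K (Alg K N) {v} = ⊤) :
    LieSubmodule.lieSpan K (Alg K N) {f v} = ⊤ := by
  have h : LieSubmodule.lieSpan K (Alg K N) {v} ≤
      (LieSubmodule.lieSpan K (Alg K N) {f v}).comap f :=
    LieSubmodule.lieSpan_le.mpr (Set.singleton_subset_iff.mpr (LieSubmodule.subset_lieSpan rfl))
  rw [hgen] at h
  refine eq_top_iff.mpr fun w _ => ?_
  obtain ⟨v', rfl⟩ := hf w
  exact h (LieSubmodule.mem_top v')

omit [LieModule K (Alg K N) V] [LieModule K (Alg K N) W] in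
theorem eq_of_eq_on_generator {f g : V →ₗ⁅K,Alg K N⁆ W} {v : V}
    (hgen : LieSubmodule.lieSpan K (Alg K N) {v} = ⊤) (h : f v = g v) (w : V) : f w = g w := by
  have h1 : LieSubmodule.lieSpan K (Alg K N) {v} ≤ (f - g).ker := by
    refine LieSubmodule.lieSpan_le.mpr (Set.singleton_subset_iff.mpr ?_)
    change v ∈ (f - g).ker
    rw [LieModuleHom.mem_ker, LieModuleHom.sub_apply, h, sub_self]
  rw [hgen] at h1
  have h2 := (LieModuleHom.mem_ker).mp (h1 (LieSubmodule.mem_top w))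
  rw [LieModuleHom.sub_apply] at h2
  exact sub_eq_zero.mp h2

/-- A bijective homomorphism of modules is an isomorphism. -/
noncomputable def lieModuleEquivOfBijective (f : V →ₗ⁅K,Alg K N⁆ W) (hf : Function.Bijective f) :
    V ≃ₗ⁅K,Alg K N⁆ W :=
  { f with
    invFun := (Equiv.ofBijective f hf).symm
    left_inv := (Equiv.ofBijective f hf).left_inv
    right_inv := (Equiv.ofBijective f hf).right_inv }

omit [LieModule K (Alg K N) V] [LieModule K (Alg K N) W] in
theorem nonempty_equiv_of_surjective [LieModule.IsIrreducible K (Alg K N) V]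
    (f : V →ₗ⁅K,Alg K N⁆ W) (hf : Function.Surjective f) {w : W} (hw : w ≠ 0) :
    Nonempty (W ≃ₗ⁅K,Alg K N⁆ V) := by
  refine ⟨(lieModuleEquivOfBijective f ⟨?_, hf⟩).symm⟩
  refine (LieModuleHom.ker_eq_bot f).mp ((eq_bot_or_eq_top f.ker).resolve_right fun h => ?_)
  obtain ⟨v, rfl⟩ := hf w
  have : v ∈ f.ker := h ▸ LieSubmodule.mem_top v
  exact hw (LieModuleHom.mem_ker.mp this)

/-- The homomorphism from a quotient induced by a homomorphism vanishing on the submodule. -/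
def liftQuotient (I : LieSubmodule K (Alg K N) V) (f : V →ₗ⁅K,Alg K N⁆ W) (h : I ≤ f.ker) :
    V ⧸ I →ₗ⁅K,Alg K N⁆ W :=
  { I.toSubmodule.liftQ (f : V →ₗ[K] W) h with
    map_lie' := fun {x m} => by
      obtain ⟨v, rfl⟩ := LieSubmodule.Quotient.surjective_mk' I m
      exact LieModuleHom.map_lie f x v }

omit [LieModule K (Alg K N) W] in
theorem liftQuotient_mk (I : LieSubmodule K (Alg K N) V) (f : V →ₗ⁅K,Alg K N⁆ W) (h : I ≤ f.ker)
    (v : V) : liftQuotient I f h (LieSubmodule.Quotient.mk' I v) = f v := rfl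

end HighestWeight

/-! ### Identification of the Verma module with the polynomial module -/

section VermaModule

variable {K : Type*} [Field K] [CharZero K] {N : ℕ} {δ μ : K}

theorem mk_eq_smul_hwv (u : U K N) :
    (Submodule.Quotient.mk u : Verma N δ μ) = u • hwv N δ μ := by
  unfold hwv
  rw [← Submodule.Quotient.mk_smul, smul_eq_mul, mul_one]

theorem hwv_isHighestWeightVector : IsHighestWeightVector N δ μ (hwv N δ μ) where
  lie_D := by
    rw [verma_lie_def, ← algebraMap_smul (U K N) δ, ← mk_eq_smul_hwv, ← mk_eq_smul_hwv]
    exact (Submodule.Quotient.eq _).mpr (Submodule.subset_span (Or.inr (Or.inl rfl)))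
  lie_M := by
    rw [verma_lie_def, ← algebraMap_smul (U K N) μ, ← mk_eq_smul_hwv, ← mk_eq_smul_hwv]
    exact (Submodule.Quotient.eq _).mpr (Submodule.subset_span (Or.inr (Or.inr rfl)))
  lie_gPlus x hx := by
    rw [verma_lie_def, ← mk_eq_smul_hwv]
    exact (Submodule.Quotient.mk_eq_zero _).mpr (Submodule.subset_span (Or.inl ⟨x, hx, rfl⟩))

theorem envRep_verma (u : U K N) (w : Verma N δ μ) : envRep K N (Verma N δ μ) u w = u • w := by
  have h : envRep K N (Verma N δ μ) = Algebra.lsmul K K (Verma N δ μ) := by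
    refine UniversalEnvelopingAlgebra.hom_ext K (LieHom.ext fun x => LinearMap.ext fun w => ?_)
    exact envRep_toU x w
  rw [h]
  rfl

theorem lieSpan_hwv : LieSubmodule.lieSpan K (Alg K N) {hwv N δ μ} = ⊤ := by
  refine eq_top_iff.mpr fun w _ => ?_
  obtain ⟨u, rfl⟩ := Submodule.Quotient.mk_surjective _ w
  rw [mk_eq_smul_hwv, ← envRep_verma]
  exact envRep_mem _ u (LieSubmodule.subset_lieSpan rfl)

variable {W : Type*} [AddCommGroup W] [Module K W] [LieRingModule (Alg K N) W]
  [LieModule K (Alg K N) W]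

theorem exists_verma_hom {v : W} (hv : IsHighestWeightVector N δ μ v) :
    ∃ f : Verma N δ μ →ₗ⁅K,Alg K N⁆ W, f (hwv N δ μ) = v := by
  -- With `W` viewed as a `U(g)`-module, the map is `u ↦ u v`, which kills the generators of the
  -- left ideal.
  let _ : Module (U K N) W := Module.compHom W (envRep K N W).toRingHom
  have smul_def : ∀ (u : U K N) (w : W), u • w = envRep K N W u w := fun _ _ => rfl
  have hle : vermaIdeal N δ μ ≤ (LinearMap.toSpanSingleton (U K N) W v).ker := by
    refine Submodule.span_le.mpr ?_
    rintro u (⟨x, hx, rfl⟩ | rfl | rfl)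
    · change toU K N x • v = 0
      rw [smul_def, envRep_toU, hv.lie_gPlus x hx]
    · change (toU K N (D K N) - algebraMap K (U K N) δ) • v = 0
      rw [smul_def, map_sub, LinearMap.sub_apply, envRep_toU, hv.lie_D, AlgHom.commutes]
      exact sub_self _
    · change (toU K N (M K N) - algebraMap K (U K N) μ) • v = 0
      rw [smul_def, map_sub, LinearMap.sub_apply, envRep_toU, hv.lie_M, AlgHom.commutes]
      exact sub_self _
  let f := (vermaIdeal N δ μ).liftQ (LinearMap.toSpanSingleton (U K N) W v) hle
  refine ⟨{ toFun := f, map_add' := map_add f, map_smul' := fun a w => ?_,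
            map_lie' := fun {x w} => ?_ }, ?_⟩
  · rw [← algebraMap_smul (U K N) a w, map_smul, smul_def, AlgHom.commutes]
    rfl
  · change f (toU K N x • w) = _
    rw [map_smul, smul_def, envRep_toU]
  · change f (hwv N δ μ) = v
    exact one_smul (U K N) v

omit [LieModule K (Alg K N) W] in
theorem exists_mem_ne_zero {S : LieSubmodule K (Alg K N) W} (hS : S ≠ ⊥) : ∃ w ∈ S, w ≠ 0 := by
  by_contra! h
  exact hS ((LieSubmodule.eq_bot_iff S).mpr h)

omit [CharZero K] in
theorem oscLin_intertwines {V : Type*} [AddCommGroup V] [Module K V] {Ψ : Fock K N →ₗ[K] V}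
    {p₀ : ℕ → Module.End K (Fock K N)} {c₀ d₀ h₀ : Module.End K (Fock K N)}
    {p : ℕ → Module.End K V} {c d h : Module.End K V} (hp : ∀ n, Intertwines Ψ (p₀ n) (p n))
    (hc : Intertwines Ψ c₀ c) (hd : Intertwines Ψ d₀ d) (hh : Intertwines Ψ h₀ h) (x : Alg K N) :
    Intertwines Ψ (oscLin N μ p₀ c₀ d₀ h₀ x) (oscLin N μ p c d h x) := by
  have hx : x ∈ Submodule.span K (Set.range (genBasis K N)) := by
    rw [(genBasis K N).span_eq]
    trivial
  induction hx using Submodule.span_induction with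
  | mem x hx =>
    obtain ⟨i, rfl⟩ := hx
    change Intertwines Ψ (oscLin N μ p₀ c₀ d₀ h₀ (gen K i)) (oscLin N μ p c d h (gen K i))
    rw [oscLin_gen, oscLin_gen]
    cases i with
    | C => exact hc.add (Intertwines.quad hp fun n => (hp _).smul _)
    | D => exact hd.add (Intertwines.quad hp fun n => (hp _).smul _)
    | H => exact hh.add (Intertwines.quad hp fun n => (hp _).smul _)
    | M =>
      simp only [oscGen, Algebra.algebraMap_eq_smul_one]
      exact Intertwines.one.smul _
    | P n => exact hp n
  | zero =>
    rw [map_zero, map_zero]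
    exact Intertwines.zero
  | add x y _ _ hx hy =>
    rw [map_add, map_add]
    exact hx.add hy
  | smul a x _ hx =>
    rw [map_smul, map_smul]
    exact hx.smul a

theorem fockPow_zero_isHighestWeightVector (hμ : μ ≠ 0) :
    IsHighestWeightVector N δ μ (fockPow (N := N) hμ (δ + 1 / 2 * ((N : K) + 1) ^ 2) 0) where
  lie_D := by
    rw [fockMod_D_pow]
    congr 1
    push_cast
    ring
  lie_M := fockMod_M _ _ _
  lie_gPlus x hx := by
    rcases hx with rfl | ⟨n, hn, rfl⟩
    · refine fockMod_H_pow _ _ ?_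
      rw [pow_zero]
      exact fockH_one _
    · exact fockMod_P_pow _ _ hn 0

/-- The shift `(N+1)²/2` compensates the scalar by which `quadD` acts on the vacuum, so that `D -
quadD` has eigenvalue `lam` on `v`. -/
theorem exists_fockMod_hom (hμ : μ ≠ 0) {v : W} (hv : IsHighestWeightVector N δ μ v)
    (hgen : LieSubmodule.lieSpan K (Alg K N) {v} = ⊤) :
    ∃ f : FockMod N hμ (δ + 1 / 2 * ((N : K) + 1) ^ 2) →ₗ⁅K,Alg K N⁆ W,
      f (fockPow hμ _ 0) = v := by
  have hM := lie_M_eq hv.lie_M hgen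
  have hp : ∀ n ≤ N, opP K N W n v = 0 := fun n hn => hv.lie_P hn
  obtain ⟨Ψ, h1, hP, hC, hD, hH⟩ := exists_intertwiner (lam := δ + 1 / 2 * ((N : K) + 1) ^ 2)
    (exists_sl2 hμ hM) hp (by
      rw [LinearMap.sub_apply, quadD_vacuum (opP_heisenberg hM) hp hμ]
      change ⁅D K N, v⁆ - _ = _
      rw [hv.lie_D]
      module) (by
      rw [LinearMap.sub_apply, quadH_vacuum (opP_heisenberg hM) hp, sub_zero]
      exact hv.lie_H)
  have hΨ := oscLin_intertwines (μ := μ) hP hC hD hH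
  refine ⟨{ Ψ with
    map_lie' := fun {x f} => ?_ }, ?_⟩
  · have h := hΨ x f
    rw [← toEnd_eq_oscLin hM] at h
    exact h
  · change Ψ ((MvPolynomial.X none : Fock K N) ^ 0) = v
    rw [pow_zero, h1]

/-- The universal properties give maps in both directions that match the generators. The composite
on the Verma module is the identity, and the map to polynomials is onto because its image contains
`1`. No Poincaré–Birkhoff–Witt theorem is needed. -/
theorem exists_verma_equiv (hμ : μ ≠ 0) :
    ∃ e : Verma N δ μ ≃ₗ⁅K,Alg K N⁆ FockMod N hμ (δ + 1 / 2 * ((N : K) + 1) ^ 2),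
      e (hwv N δ μ) = fockPow hμ _ 0 := by
  obtain ⟨φ, hφ⟩ := exists_verma_hom (fockPow_zero_isHighestWeightVector (δ := δ) (N := N) hμ)
  obtain ⟨ψ, hψ⟩ := exists_fockMod_hom hμ (hwv_isHighestWeightVector (N := N) (δ := δ)) lieSpan_hwv
  have h1 : ∀ w, ψ (φ w) = w :=
    eq_of_eq_on_generator (f := ψ.comp φ) (g := LieModuleHom.id) lieSpan_hwv (by
      rw [LieModuleHom.comp_apply, hφ, hψ, LieModuleHom.id_apply])
  have h2 : Function.Surjective φ := by
    have h : φ.range = ⊤ := by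
      refine eq_top_of_one_mem _ ?_
      have h3 : fockPow (N := N) hμ (δ + 1 / 2 * ((N : K) + 1) ^ 2) 0 ∈ φ.range := ⟨_, hφ⟩
      exact pow_zero (MvPolynomial.X none : Fock K N) ▸ h3
    intro f
    have hf : f ∈ φ.range := h ▸ LieSubmodule.mem_top f
    exact hf
  exact ⟨lieModuleEquivOfBijective φ ⟨Function.LeftInverse.injective h1, h2⟩, hφ⟩

omit [CharZero K] in
theorem fockPow_ne_zero (hμ : μ ≠ 0) (lam : K) (k : ℕ) : fockPow (N := N) hμ lam k ≠ 0 :=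
  pow_ne_zero (M₀ := Fock K N) k (MvPolynomial.X_ne_zero none)

theorem hwv_ne_zero (hμ : μ ≠ 0) : hwv N δ μ ≠ 0 := by
  obtain ⟨e, he⟩ := exists_verma_equiv (N := N) (δ := δ) hμ
  intro h
  rw [h] at he
  exact fockPow_ne_zero hμ _ 0 (he.symm.trans (map_zero e.toLieModuleHom))

theorem verma_isHighestWeightModule (hμ : μ ≠ 0) :
    IsHighestWeightModule N δ μ (Verma N δ μ) :=
  ⟨hwv N δ μ, hwv_ne_zero hμ, hwv_isHighestWeightVector.lie_D, hwv_isHighestWeightVector.lie_M,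
    hwv_isHighestWeightVector.lie_gPlus, lieSpan_hwv⟩

theorem equiv_singVec (hμ : μ ≠ 0) {lam : K} (e : Verma N δ μ ≃ₗ⁅K,Alg K N⁆ FockMod N hμ lam)
    (he : e (hwv N δ μ) = fockPow hμ lam 0) (q : ℕ) :
    e (singVec N δ μ q) = (2 * (N.factorial : K) ^ 2 * μ) ^ q • fockPow hμ lam q := by
  induction q with
  | zero =>
    unfold singVec
    rw [pow_zero, pow_zero, one_smul, one_smul, he]
  | succ q ih =>
    have h : singVec N δ μ (q + 1) = (2 * (N.factorial : K) ^ 2 * μ) • ⁅C K N, singVec N δ μ q⁆ -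
        ⁅P K N (N + 1), ⁅P K N (N + 1), singVec N δ μ q⁆⁆ := by
      unfold singVec
      rw [pow_succ', mul_smul, sub_smul, smul_assoc (2 * (N.factorial : K) ^ 2 * μ),
        pow_two (toU K N (P K N (N + 1))), mul_smul (toU K N (P K N (N + 1)))]
      rfl
    have e_lie : ∀ x w, e ⁅x, w⁆ = ⁅x, e w⁆ := fun x w => LieModuleHom.map_lie e.toLieModuleHom x w
    have e_sub : ∀ v w, e (v - w) = e v - e w := fun v w => map_sub e.toLieModuleHom v w
    have e_smul : ∀ (a : K) w, e (a • w) = a • e w := fun a w => map_smul e.toLieModuleHom a w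
    rw [h, e_sub, e_smul, e_lie, e_lie, e_lie, ih, lie_smul, lie_smul, lie_smul, smul_comm,
      ← smul_sub, fockMod_C_pow, smul_smul, ← pow_succ]

theorem alpha_ne_zero (hμ : μ ≠ 0) : 2 * (N.factorial : K) ^ 2 * μ ≠ 0 := by
  have h1 : (N.factorial : K) ≠ 0 := by exact_mod_cast N.factorial_ne_zero
  simp [h1, hμ]

theorem verma_irreducible (hμ : μ ≠ 0) (hδ : ∀ q : ℕ, 1 ≤ q → δ ≠ excWeight K N q) :
    LieModule.IsIrreducible K (Alg K N) (Verma N δ μ) := by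
  obtain ⟨e, he⟩ := exists_verma_equiv (N := N) (δ := δ) hμ
  have : Nontrivial (Verma N δ μ) := ⟨hwv N δ μ, 0, hwv_ne_zero hμ⟩
  refine LieModule.IsIrreducible.mk fun S hS => ?_
  obtain ⟨w, hw, hw0⟩ := exists_mem_ne_zero hS
  have h : S.comap e.symm.toLieModuleHom = ⊤ := by
    refine eq_top_of_ne_zero (f := e w) _ (fun n hn => hδ (n + 1) (by omega) ?_) ?_ ?_
    · unfold excWeight
      push_cast
      linear_combination hn
    · change e.symm (e w) ∈ S
      rwa [LieModuleEquiv.symm_apply_apply]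
    · intro h
      refine hw0 (e.injective (h.trans (map_zero e.toLieModuleHom).symm))
  refine eq_top_iff.mpr fun v _ => ?_
  have hv : e v ∈ S.comap e.symm.toLieModuleHom := h ▸ LieSubmodule.mem_top _
  change e.symm (e v) ∈ S at hv
  rwa [LieModuleEquiv.symm_apply_apply] at hv

/-! ### The exceptional weights -/

section Exceptional

variable {q : ℕ}

theorem lam_of_excWeight (hδ : δ = excWeight K N q) :
    δ + 1 / 2 * ((N : K) + 1) ^ 2 = q - 1 := by
  rw [hδ]
  unfold excWeight
  ring

/-- Transported to polynomials this concerns the `q`-th power of `none`, killed by `fockH lam`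
exactly because `lam = q - 1`. -/
theorem singVec_isHighestWeightVector (hμ : μ ≠ 0) (hδ : δ = excWeight K N q) :
    IsHighestWeightVector N (δ - 2 * q) μ (singVec N δ μ q) := by
  obtain ⟨e, he⟩ := exists_verma_equiv (N := N) (δ := δ) hμ
  have h1 : IsHighestWeightVector N (δ - 2 * q) μ
      (fockPow (N := N) hμ (δ + 1 / 2 * ((N : K) + 1) ^ 2) q) := by
    refine ⟨?_, fockMod_M _ _ _, ?_⟩
    · rw [fockMod_D_pow, add_sub_cancel_right]
    · rintro x (rfl | ⟨n, hn, rfl⟩)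
      · exact fockMod_H_pow _ _ (fockH_X_pow _ (lam_of_excWeight hδ))
      · exact fockMod_P_pow _ _ hn q
  have h2 := (h1.smul ((2 * (N.factorial : K) ^ 2 * μ) ^ q)).map e.symm.toLieModuleHom
  rw [← equiv_singVec hμ e he] at h2
  change IsHighestWeightVector N (δ - 2 * q) μ (e.symm (e (singVec N δ μ q))) at h2
  rwa [LieModuleEquiv.symm_apply_apply] at h2

theorem singSub_eq_uMinusSpan (hμ : μ ≠ 0) (hδ : δ = excWeight K N q) :
    (singSub N δ μ q).toSubmodule = UMinusSpan N (singVec N δ μ q) := by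
  unfold singSub
  rw [lieSpan_eq_uMinusSubmodule (singVec_isHighestWeightVector hμ hδ)]
  ext w
  constructor
  · rintro ⟨u, hu, rfl⟩
    exact ⟨u, hu, (envRep_verma u (singVec N δ μ q)).symm⟩
  · rintro ⟨u, hu, rfl⟩
    exact ⟨u, hu, envRep_verma u (singVec N δ μ q)⟩

theorem singVec_ne_zero (hμ : μ ≠ 0) : singVec N δ μ q ≠ 0 := by
  obtain ⟨e, he⟩ := exists_verma_equiv (N := N) (δ := δ) hμ
  intro h
  have h1 := equiv_singVec hμ e he q
  rw [h] at h1
  exact smul_ne_zero (pow_ne_zero q (alpha_ne_zero hμ)) (fockPow_ne_zero hμ _ q)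
    (h1.symm.trans (map_zero e.toLieModuleHom))

theorem singSub_le_comap_fockIdealLie (hμ : μ ≠ 0) (hδ : δ = excWeight K N q)
    (e : Verma N δ μ ≃ₗ⁅K,Alg K N⁆ FockMod N hμ (δ + 1 / 2 * ((N : K) + 1) ^ 2))
    (he : e (hwv N δ μ) = fockPow hμ _ 0) :
    singSub N δ μ q ≤ (fockIdealLie hμ _ (lam_of_excWeight hδ)).comap e.toLieModuleHom := by
  refine LieSubmodule.lieSpan_le.mpr (Set.singleton_subset_iff.mpr ?_)
  change e (singVec N δ μ q) ∈ fockIdealLie hμ _ (lam_of_excWeight hδ)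
  rw [equiv_singVec hμ e he]
  exact Submodule.smul_mem (fockIdeal K N q) _ (X_pow_mem_fockIdeal q)

theorem hwv_notMem_singSub (hμ : μ ≠ 0) (hq : 1 ≤ q) (hδ : δ = excWeight K N q) :
    hwv N δ μ ∉ singSub N δ μ q := by
  obtain ⟨e, he⟩ := exists_verma_equiv (N := N) (δ := δ) hμ
  intro h
  have h1 : e (hwv N δ μ) ∈ fockIdealLie hμ _ (lam_of_excWeight hδ) :=
    singSub_le_comap_fockIdealLie hμ hδ e he h
  rw [he] at h1
  have h2 : (MvPolynomial.X none : Fock K N) ^ 0 ∈ fockIdeal K N q := h1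
  rw [pow_zero] at h2
  exact one_notMem_fockIdeal hq h2

theorem verma_not_irreducible (hμ : μ ≠ 0) (hq : 1 ≤ q) (hδ : δ = excWeight K N q) :
    ¬ LieModule.IsIrreducible K (Alg K N) (Verma N δ μ) := by
  intro h
  rcases eq_bot_or_eq_top (singSub N δ μ q) with h1 | h1
  · have h2 : singVec N δ μ q ∈ singSub N δ μ q := LieSubmodule.subset_lieSpan rfl
    rw [h1] at h2
    exact singVec_ne_zero hμ ((LieSubmodule.mem_bot _).mp h2)
  · exact hwv_notMem_singSub hμ hq hδ (h1 ▸ LieSubmodule.mem_top _)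

/-- Maximality of the singular submodule: in the polynomial model it contains all of `fockIdeal K N
q`, so a vector outside it has a nonzero coefficient below exponent `q` and the degree reduction
reaches `1`. -/
theorem eq_top_of_singSub_lt (hμ : μ ≠ 0) (hδ : δ = excWeight K N q)
    {S : LieSubmodule K (Alg K N) (Verma N δ μ)} (hS : singSub N δ μ q < S) : S = ⊤ := by
  obtain ⟨e, he⟩ := exists_verma_equiv (N := N) (δ := δ) hμ
  obtain ⟨hle, w, hw, hw'⟩ := SetLike.lt_iff_le_and_exists.mp hS
  have mem_pow : ∀ {T : LieSubmodule K (Alg K N) (Verma N δ μ)}, singVec N δ μ q ∈ T →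
      (MvPolynomial.X none : Fock K N) ^ q ∈ fockSubmodule (T.comap e.symm.toLieModuleHom) := by
    intro T hT
    have h1 : e (singVec N δ μ q) ∈ T.comap e.symm.toLieModuleHom := by
      change e.symm (e (singVec N δ μ q)) ∈ T
      rwa [LieModuleEquiv.symm_apply_apply]
    rw [equiv_singVec hμ e he] at h1
    have h2 := (T.comap e.symm.toLieModuleHom).toSubmodule.smul_mem
      ((2 * (N.factorial : K) ^ 2 * μ) ^ q)⁻¹ h1
    rwa [smul_smul, inv_mul_cancel₀ (pow_ne_zero q (alpha_ne_zero hμ)), one_smul] at h2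
  have hsing : singVec N δ μ q ∈ singSub N δ μ q := LieSubmodule.subset_lieSpan rfl
  have h : S.comap e.symm.toLieModuleHom = ⊤ := by
    refine eq_top_of_notMem_fockIdeal (f := e w) _ (lam_of_excWeight hδ) (mem_pow (hle hsing)) ?_ ?_
    · change e.symm (e w) ∈ S
      rwa [LieModuleEquiv.symm_apply_apply]
    · intro h1
      have h2 := fockIdeal_le _ (mem_pow hsing) h1
      change e.symm (e w) ∈ singSub N δ μ q at h2
      rw [LieModuleEquiv.symm_apply_apply] at h2
      exact hw' h2
  refine eq_top_iff.mpr fun v _ => ?_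
  have hv : e v ∈ S.comap e.symm.toLieModuleHom := h ▸ LieSubmodule.mem_top _
  change e.symm (e v) ∈ S at hv
  rwa [LieModuleEquiv.symm_apply_apply] at hv

theorem quotient_hwv_ne_zero (hμ : μ ≠ 0) (hq : 1 ≤ q) (hδ : δ = excWeight K N q) :
    LieSubmodule.Quotient.mk' (singSub N δ μ q) (hwv N δ μ) ≠ 0 := fun h =>
  hwv_notMem_singSub hμ hq hδ ((LieSubmodule.Quotient.mk_eq_zero _).mp h)

theorem quotient_isHighestWeightModule (hμ : μ ≠ 0) (hq : 1 ≤ q) (hδ : δ = excWeight K N q) :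
    IsHighestWeightModule N δ μ (Verma N δ μ ⧸ singSub N δ μ q) := by
  have h := (hwv_isHighestWeightVector (N := N) (δ := δ) (μ := μ)).map
    (LieSubmodule.Quotient.mk' (singSub N δ μ q))
  exact ⟨_, quotient_hwv_ne_zero hμ hq hδ, h.lie_D, h.lie_M, h.lie_gPlus,
    lieSpan_map_eq_top (LieSubmodule.Quotient.surjective_mk' _) lieSpan_hwv⟩

theorem quotient_irreducible (hμ : μ ≠ 0) (hq : 1 ≤ q) (hδ : δ = excWeight K N q) :
    LieModule.IsIrreducible K (Alg K N) (Verma N δ μ ⧸ singSub N δ μ q) := by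
  have : Nontrivial (Verma N δ μ ⧸ singSub N δ μ q) := ⟨_, 0, quotient_hwv_ne_zero hμ hq hδ⟩
  refine LieModule.IsIrreducible.mk fun S hS => ?_
  obtain ⟨m, hm, hm0⟩ := exists_mem_ne_zero hS
  obtain ⟨w, rfl⟩ := LieSubmodule.Quotient.surjective_mk' _ m
  have h : S.comap (LieSubmodule.Quotient.mk' (singSub N δ μ q)) = ⊤ := by
    refine eq_top_of_singSub_lt hμ hδ (SetLike.lt_iff_le_and_exists.mpr ⟨fun v hv => ?_, w, hm, ?_⟩)
    · change LieSubmodule.Quotient.mk' (singSub N δ μ q) v ∈ S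
      rw [(LieSubmodule.Quotient.mk_eq_zero _).mpr hv]
      exact S.zero_mem
    · exact fun hw => hm0 ((LieSubmodule.Quotient.mk_eq_zero _).mpr hw)
  refine eq_top_iff.mpr fun m _ => ?_
  obtain ⟨v, rfl⟩ := LieSubmodule.Quotient.surjective_mk' _ m
  have hv : v ∈ S.comap (LieSubmodule.Quotient.mk' (singSub N δ μ q)) :=
    h ▸ LieSubmodule.mem_top v
  exact hv

end Exceptional

/-! ### Classification of irreducible highest weight modules -/

theorem nonempty_equiv_verma (hμ : μ ≠ 0) (hδ : ∀ q : ℕ, 1 ≤ q → δ ≠ excWeight K N q)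
    (hW : IsHighestWeightModule N δ μ W) : Nonempty (W ≃ₗ⁅K,Alg K N⁆ Verma N δ μ) := by
  obtain ⟨v, hv0, hD, hM, hP, hgen⟩ := hW
  obtain ⟨f, hf⟩ := exists_verma_hom (v := v) ⟨hD, hM, hP⟩
  have := verma_irreducible hμ hδ
  exact nonempty_equiv_of_surjective f (surjective_of_generator f (hf.symm ▸ hgen)) hv0

theorem nonempty_equiv_quotient [LieModule.IsIrreducible K (Alg K N) W] (hμ : μ ≠ 0) {q : ℕ}
    (hq : 1 ≤ q) (hδ : δ = excWeight K N q) (hW : IsHighestWeightModule N δ μ W) :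
    Nonempty (W ≃ₗ⁅K,Alg K N⁆ (Verma N δ μ ⧸ singSub N δ μ q)) := by
  obtain ⟨v, hv0, hD, hM, hP, hgen⟩ := hW
  obtain ⟨f, hf⟩ := exists_verma_hom (v := v) ⟨hD, hM, hP⟩
  -- Otherwise the image would be a highest weight vector of weight `δ - 2q` generating the
  -- irreducible module `W`, so the weight `δ` of `v` would lie in `δ - 2q - ℕ`, impossible for `q ≥
  -- 1`.
  have hs : f (singVec N δ μ q) = 0 := by
    by_contra hs
    have h1 : LieSubmodule.lieSpan K (Alg K N) {f (singVec N δ μ q)} = ⊤ := by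
      refine (eq_bot_or_eq_top _).resolve_left fun h => hs ?_
      have h2 : f (singVec N δ μ q) ∈ LieSubmodule.lieSpan K (Alg K N) {f (singVec N δ μ q)} :=
        LieSubmodule.subset_lieSpan rfl
      rw [h] at h2
      exact (LieSubmodule.mem_bot _).mp h2
    obtain ⟨j, hj⟩ := weight_eq_sub ((singVec_isHighestWeightVector hμ hδ).map f) h1 hv0 hD
    have h2 : ((2 * q + j : ℕ) : K) = 0 := by
      push_cast
      linear_combination hj
    have h3 : 2 * q + j = 0 := by exact_mod_cast h2
    omega
  have hle : singSub N δ μ q ≤ f.ker :=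
    LieSubmodule.lieSpan_le.mpr (Set.singleton_subset_iff.mpr (LieModuleHom.mem_ker.mpr hs))
  have := quotient_irreducible hμ hq hδ
  refine nonempty_equiv_of_surjective (liftQuotient _ f hle) (fun w => ?_) hv0
  obtain ⟨u, rfl⟩ := surjective_of_generator f (hf.symm ▸ hgen) w
  exact ⟨LieSubmodule.Quotient.mk' _ u, liftQuotient_mk _ f hle u⟩

end VermaModule

end CGA

theorem theorem5 {𝕜 : Type*} [RCLike 𝕜] (N : ℕ) (δ μ : 𝕜) (hμ : μ ≠ 0) :
    -- the Verma module away from the exceptional weights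
    ((∀ q : ℕ, 1 ≤ q → δ ≠ CGA.excWeight 𝕜 N q) →
      LieModule.IsIrreducible 𝕜 (CGA.Alg 𝕜 N) (CGA.Verma N δ μ)) ∧
    CGA.IsHighestWeightModule N δ μ (CGA.Verma N δ μ) ∧
    ¬ FiniteDimensional 𝕜 (CGA.Verma N δ μ) ∧
    -- the quotient of the Verma module at an exceptional weight
    (∀ q : ℕ, 1 ≤ q → δ = CGA.excWeight 𝕜 N q →
      ¬ LieModule.IsIrreducible 𝕜 (CGA.Alg 𝕜 N) (CGA.Verma N δ μ) ∧
      (CGA.singSub N δ μ q).toSubmodule = CGA.UMinusSpan N (CGA.singVec N δ μ q) ∧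
      LieModule.IsIrreducible 𝕜 (CGA.Alg 𝕜 N) (CGA.Verma N δ μ ⧸ CGA.singSub N δ μ q) ∧
      CGA.IsHighestWeightModule N δ μ (CGA.Verma N δ μ ⧸ CGA.singSub N δ μ q) ∧
      ¬ FiniteDimensional 𝕜 (CGA.Verma N δ μ ⧸ CGA.singSub N δ μ q)) ∧
    -- the list is complete and without repetition
    (∀ (W : Type*) [AddCommGroup W] [Module 𝕜 W] [LieRingModule (CGA.Alg 𝕜 N) W]
      [LieModule 𝕜 (CGA.Alg 𝕜 N) W],
      LieModule.IsIrreducible 𝕜 (CGA.Alg 𝕜 N) W → CGA.IsHighestWeightModule N δ μ W →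
        ((∀ q : ℕ, 1 ≤ q → δ ≠ CGA.excWeight 𝕜 N q) →
          Nonempty (W ≃ₗ⁅𝕜, CGA.Alg 𝕜 N⁆ CGA.Verma N δ μ)) ∧
        (∀ q : ℕ, 1 ≤ q → δ = CGA.excWeight 𝕜 N q →
          Nonempty (W ≃ₗ⁅𝕜, CGA.Alg 𝕜 N⁆ (CGA.Verma N δ μ ⧸ CGA.singSub N δ μ q))) ∧
        (∀ δ' μ' : 𝕜, CGA.IsHighestWeightModule N δ' μ' W → δ' = δ ∧ μ' = μ)) := by
  refine ⟨CGA.verma_irreducible hμ, CGA.verma_isHighestWeightModule hμ,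
    CGA.not_finiteDimensional_of_hwm hμ (CGA.verma_isHighestWeightModule hμ), ?_, ?_⟩
  · intro q hq hδ
    exact ⟨CGA.verma_not_irreducible hμ hq hδ, CGA.singSub_eq_uMinusSpan hμ hδ,
      CGA.quotient_irreducible hμ hq hδ, CGA.quotient_isHighestWeightModule hμ hq hδ,
      CGA.not_finiteDimensional_of_hwm hμ (CGA.quotient_isHighestWeightModule hμ hq hδ)⟩
  · intro W _ _ _ _ _ hW
    exact ⟨fun hδ => CGA.nonempty_equiv_verma hμ hδ hW,
      fun q hq hδ => CGA.nonempty_equiv_quotient hμ hq hδ hW,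
      fun δ' μ' h' => CGA.weights_unique hW h'⟩
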